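/- Setting. Work in the one-sorted (points only), quantifier-free first-order language with constants $\alpha,\beta,\gamma$, relations $B(a,b,c)$ (strict betweenness), $SO(abc,def)$ (same orientation of angles), $ab\cong cd$ (segment congruence), $abc\cong def$ (angle congruence), and constructions (function symbols) $cb(d,abc)$ (crossbow), $ext(ab,cd)$ (segment extension), $ats(abc,def)$ (angle transport), $mid(a,b)$, and $cci(c_1,a,b,c_2,d)$ (circle-circle intersection). Define: - $L(a,b,c)$: $B(a,b,c)\lor B(a,c,b)\lor B(b,a,c)$; $T(a,b,c)$: $\neg L(a,b,c)$ and $a,b,c$ pairwise distinct; $\widetilde L(a,b,c)$: $L(a,b,c)\lor a=b\lor b=c\lor a=c$. - $SD(a,b,c)$: $B(a,b,c)\lor B(a,c,b)\lor(a\ne b\wedge c=b)\lor(a=b\wedge c\neq b)$. - $OO(abc,def)$: $\neg SO(abc,def)\wedge T(a,b,c)\wedge T(d,e,f)$; $SS(c,d,ab)$: $SO(abc,abd)$. - $doub(a,b)=ext(ab,ab)$ if $a\ne b$, $doub(a,a)=a$; $lf(ab,cd)=ext(doub(b,a)\,a,cd)$. - $ab<cd$: $B(c,lf(cd,ab),d)\lor(a=b\wedge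 c\ne d)$. The axioms (for all points) are: 1. $B(a,b,c)\to a\ne b\wedge a\neq c$. 2. $B(a,b,c)\to B(c,b,a)$. 3. $\neg(B(a,b,c)\wedge B(a,c,b))$. 4. $c\ne d\wedge L(a,b,c)\wedge L(a,b,d)\to L(a,c,d)$. 5. $T(\alpha,\beta,\gamma)$. 6. $SO(abc,def)\to T(a,b,c)\wedge T(d,e,f)$. 7. $T(a,b,c)\to SO(abc,abc)$. 8. $SO(abc,def)\wedge SO(abc,ghi)\to SO(def,ghi)$. 9. $T(a,b,c)\wedge SD(b,a,e)\to SO(abc,ebc)$. 10. $T(a,b,c)\to OO(abc,cba)$. 11. $OO(abc,def)\wedge OO(def,ghi)\to SO(abc,ghi)$. 12. $B(a,b,c)\wedge T(a,c,d)\to OO(dba,dbc)$. 13. $OO(dba,dbc)\to\widetilde L(b,cb(d,abc),d)\wedge B(a,cb(d,abc),c)$. 14. $T(a,b,c)\to OO(abc,bac)$. 15. $ab\cong ab$ and $ab\cong ba$. 16. $a\ne b\to b\,ext(ab,cd)\cong cd$. 17. $a\neq b\wedge c\ne d\to B(a,b,ext(ab,cd))$. 18. $(B(a,b,x)\lor b=x)\wedge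 bx\cong cd\to x=ext(ab,cd)$. 19. $ab\cong cd\wedge ab\cong ef\to cd\cong ef$. 20. $B(a,b,c)\wedge B(d,e,f)\wedge ab\cong de\wedge bc\cong ef\to ac\cong df$. 21. $abc\cong def\to T(a,b,c)\wedge T(d,e,f)$. 22. $T(a,b,c)\wedge T(d,e,f)\to abc\cong dex\wedge SS(x,f,de)\wedge bc\cong ex$, where $x=ats(abc,def)$. 23. $abc\cong dex\wedge SS(f,x,de)\wedge bc\cong ex\to x=ats(abc,def)$. 24. $SD(b,c,d)\wedge T(a,b,c)\to abc\cong abd$. 25. $T(a,b,c)\to abc\cong abc\wedge abc\cong cba$. 26. $abc\cong def\wedge abc\cong ghi\to def\cong ghi$. 27. $T(a,b,c)\wedge T(d,e,f)\wedge ab\cong de\wedge ac\cong df\wedge bac\cong edf\to abc\cong def$. 28. $a\ne b\to B(a,m,b)\wedge am\cong bm$, where $m=mid(a,b)$. 29. $mid(a,a)=a$. 30. $mid(mid(a,b),mid(c,d))=mid(mid(a,c),mid(b,d))$. 31. $c_1a\cong c_1b\wedge c_2a<c_2d\wedge c_2d<c_2b\to c_1y\cong c_1a\wedge c_2y\cong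 c_2d$, where $y=cci(c_1,a,b,c_2,d)$. A uniform construction from $n$ points is a single term of the language in $n$ variables (a fixed, case-free composition of the constructions and constants); it is the same term for all models and all points. Theorem. (i) (Segment-circle continuity.) There is a uniform construction $z=z(a,b,c,d)$ such that, in every model of the axioms and for all points $a,b,c,d$ with $ca<cd$ and $cd<cb$, one has $B(a,z,b)$ and $cz\cong cd$. (ii) (Second intersection point of two circles.) There is a uniform construction $x=x(c_1,a,b,c_2,d)$ such that, in every model of the axioms and for all points $c_1,a,b,c_2,d$ with $c_1a\cong c_1b$, $c_2a<c_2d$ and $c_2d<c_2b$, one has $c_1x\cong c_1a$, $c_2x\cong c_2d$ and $x\neq cci(c_1,a,b,c_2,d)$. -/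

import Mathlib

open FirstOrder

universe u

/-! ## The language: one sort (points), quantifier-free, with constructions as function symbols -/

/-- The primitive constructions, indexed by their number of arguments, together with the three
constants `α`, `β`, `γ`. -/
inductive GeoConstruction : ℕ → Type
  | alpha : GeoConstruction 0
  | beta : GeoConstruction 0
  | gamma : GeoConstruction 0
  | crossbow : GeoConstruction 4
  | ext : GeoConstruction 4
  | ats : GeoConstruction 6
  | mid : GeoConstruction 2
  | cci : GeoConstruction 5

/-- The primitive relations, indexed by their number of arguments. -/
inductive GeoRelation : ℕ → Type
  | between : GeoRelation 3
  | sameOrientation : GeoRelation 6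
  | segCong : GeoRelation 4
  | angCong : GeoRelation 6

/-- The first-order language of straightedge, protractor and compass geometry. -/
def geoLang : Language := ⟨GeoConstruction, GeoRelation⟩

/-- A uniform (that is, case-free) construction from `n` given points: a term of the language in
`n` variables, i.e. a fixed composition of primitive constructions and constants. -/
abbrev UniformConstruction (n : ℕ) : Type := geoLang.Term (Fin n)

namespace Geo

variable {P : Type u} [geoLang.Structure P]

/-! ### Primitive notions, interpreted in a structure -/

/-- The constant `α`. -/
def alpha (P : Type u) [geoLang.Structure P] : P :=
  Language.Structure.funMap (L := geoLang) GeoConstruction.alpha ![]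

/-- The constant `β`. -/
def beta (P : Type u) [geoLang.Structure P] : P :=
  Language.Structure.funMap (L := geoLang) GeoConstruction.beta ![]

/-- The constant `γ`. -/
def gamma (P : Type u) [geoLang.Structure P] : P :=
  Language.Structure.funMap (L := geoLang) GeoConstruction.gamma ![]

/-- Crossbow construction `cb(d, abc)`. -/
def cb (d a b c : P) : P :=
  Language.Structure.funMap (L := geoLang) GeoConstruction.crossbow ![d, a, b, c]

/-- Segment extension `ext(ab, cd)`. -/
def ext (a b c d : P) : P :=
  Language.Structure.funMap (L := geoLang) GeoConstruction.ext ![a, b, c, d]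

/-- Angle transport (same side) `ats(abc, def)`. -/
def ats (a b c d e f : P) : P :=
  Language.Structure.funMap (L := geoLang) GeoConstruction.ats ![a, b, c, d, e, f]

/-- Midpoint `mid(a, b)`. -/
def mid (a b : P) : P :=
  Language.Structure.funMap (L := geoLang) GeoConstruction.mid ![a, b]

/-- Circle-circle intersection `cci(c₁, a, b, c₂, d)`. -/
def cci (c₁ a b c₂ d : P) : P :=
  Language.Structure.funMap (L := geoLang) GeoConstruction.cci ![c₁, a, b, c₂, d]

/-- `B(a, b, c)`: `b` is strictly between `a` and `c`. -/
def B (a b c : P) : Prop :=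
  Language.Structure.RelMap (L := geoLang) GeoRelation.between ![a, b, c]

/-- `SO(abc, def)`: the angles `abc` and `def` have the same orientation. -/
def SO (a b c d e f : P) : Prop :=
  Language.Structure.RelMap (L := geoLang) GeoRelation.sameOrientation ![a, b, c, d, e, f]

/-- `C(ab, cd)`, also written `ab ≅ cd`: segment congruence. -/
def C (a b c d : P) : Prop :=
  Language.Structure.RelMap (L := geoLang) GeoRelation.segCong ![a, b, c, d]

/-- `AC(abc, def)`: angle congruence. -/
def AC (a b c d e f : P) : Prop :=
  Language.Structure.RelMap (L := geoLang) GeoRelation.angCong ![a, b, c, d, e, f]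

/-! ### Defined notions -/

/-- `a`, `b`, `c` are distinct and colinear. -/
def L (a b c : P) : Prop := B a b c ∨ B a c b ∨ B b a c

/-- `a`, `b`, `c` are distinct and not colinear. -/
def T (a b c : P) : Prop := ¬ L a b c ∧ a ≠ b ∧ b ≠ c ∧ a ≠ c

/-- Non-strict colinearity. -/
def NL (a b c : P) : Prop := L a b c ∨ a = b ∨ b = c ∨ a = c

/-- Same direction: `b` and `c` are on the same side of `a`. -/
def SD (a b c : P) : Prop := B a b c ∨ B a c b ∨ (a ≠ b ∧ c = b) ∨ (a = b ∧ c ≠ b)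

/-- Opposite orientation. -/
def OO (a b c d e f : P) : Prop := ¬ SO a b c d e f ∧ T a b c ∧ T d e f

/-- `SS(c, d, ab)`: `c` and `d` are on the same side of `ab`. -/
def SS (c d a b : P) : Prop := SO a b c a b d

open Classical in
/-- Doubling construction. -/
noncomputable def doub (a b : P) : P := if a = b then a else ext a b a b

/-- Layoff construction `lf(ab, cd)`. -/
noncomputable def lf (a b c d : P) : P := ext (doub b a) a c d

/-- Segment inequality `ab < cd`. -/
def SegLT (a b c d : P) : Prop := B c (lf c d a b) d ∨ (a = b ∧ c ≠ d)

/-- The axioms of planar straightedge, protractor and compass geometry. A structure for `geoLang`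
satisfying them is a model of the theory. -/
structure IsPlane (P : Type u) [geoLang.Structure P] : Prop where
  -- order and incidence
  between_ne : ∀ a b c : P, B a b c → a ≠ b ∧ a ≠ c
  between_symm : ∀ a b c : P, B a b c → B c b a
  between_unique : ∀ a b c : P, ¬ (B a b c ∧ B a c b)
  unique_line : ∀ a b c d : P, c ≠ d → L a b c ∧ L a b d → L a c d
  constants : T (alpha P) (beta P) (gamma P)
  -- angle orientation and the crossbow construction
  so_triangle : ∀ a b c d e f : P, SO a b c d e f → T a b c ∧ T d e f
  so_refl : ∀ a b c : P, T a b c → SO a b c a b c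
  so_trans : ∀ a b c d e f g h i : P, SO a b c d e f ∧ SO a b c g h i → SO d e f g h i
  so_ray : ∀ a b c e : P, T a b c ∧ SD b a e → SO a b c e b c
  oo_reverse : ∀ a b c : P, T a b c → OO a b c c b a
  oo_oo_so : ∀ a b c d e f g h i : P, OO a b c d e f ∧ OO d e f g h i → SO a b c g h i
  oo_of_between : ∀ a b c d : P, B a b c ∧ T a c d → OO d b a d b c
  crossbow : ∀ a b c d : P, OO d b a d b c → NL b (cb d a b c) d ∧ B a (cb d a b c) c
  oo_triangle : ∀ a b c : P, T a b c → OO a b c b a c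
  -- segment congruence and extension
  seg_refl : ∀ a b : P, C a b a b ∧ C a b b a
  ext_cong : ∀ a b c d : P, a ≠ b → C b (ext a b c d) c d
  ext_between : ∀ a b c d : P, a ≠ b ∧ c ≠ d → B a b (ext a b c d)
  ext_unique : ∀ a b c d x : P, (B a b x ∨ b = x) ∧ C b x c d → x = ext a b c d
  seg_trans : ∀ a b c d e f : P, C a b c d ∧ C a b e f → C c d e f
  seg_add : ∀ a b c d e f : P, B a b c ∧ B d e f ∧ C a b d e ∧ C b c e f → C a c d f
  -- angle congruence and angle transport
  ang_triangle : ∀ a b c d e f : P, AC a b c d e f → T a b c ∧ T d e f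
  ats_spec : ∀ a b c d e f : P, T a b c ∧ T d e f →
    AC a b c d e (ats a b c d e f) ∧ SS (ats a b c d e f) f d e ∧ C b c e (ats a b c d e f)
  ats_unique : ∀ a b c d e f x : P,
    AC a b c d e x ∧ SS f x d e ∧ C b c e x → x = ats a b c d e f
  ang_ray : ∀ a b c d : P, SD b c d ∧ T a b c → AC a b c a b d
  ang_refl : ∀ a b c : P, T a b c → AC a b c a b c ∧ AC a b c c b a
  ang_trans : ∀ a b c d e f g h i : P, AC a b c d e f ∧ AC a b c g h i → AC d e f g h i
  side_angle_side : ∀ a b c d e f : P,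
    T a b c ∧ T d e f ∧ C a b d e ∧ C a c d f ∧ AC b a c e d f → AC a b c d e f
  -- midpoints
  mid_spec : ∀ a b : P, a ≠ b → B a (mid a b) b ∧ C a (mid a b) b (mid a b)
  mid_self : ∀ a : P, mid a a = a
  mid_bisymm : ∀ a b c d : P, mid (mid a b) (mid c d) = mid (mid a c) (mid b d)
  -- circle-circle intersection
  cci_spec : ∀ c₁ a b c₂ d : P, C c₁ a c₁ b ∧ SegLT c₂ a c₂ d ∧ SegLT c₂ d c₂ b →
    C c₁ (cci c₁ a b c₂ d) c₁ a ∧ C c₂ (cci c₁ a b c₂ d) c₂ d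

end Geo

/-! The axioms amount to a Hilbert plane with an intersection point for properly crossing circles,
so both parts reduce to reflection in a line and the strict triangle inequality. `orient` turns
orientation into a sign, so order arguments become arithmetic of signs. Congruence classes of
segments form a cancellative linearly ordered monoid `Len`, so comparisons of segments become linear
arithmetic. `SAS`, `exterior_angle` and `dist_lt_of_T` then follow as in Euclid.

For (ii), the triangle inequality gives |c₁c₂ - c₁a| ≤ c₂a < c₂d < c₂b ≤ c₁c₂ + c₁a. So the `cci`
point is off the line of centres, and its reflection in that line is a second intersection.

For (i) with `c` off the line `ab`, let `c'` be its mirror image and `k` the foot. Equal circles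
around `c` and `c'` meet on `ab`. The `cci` point may lie on the wrong side of `k`, so its distance
from `k` is laid off on the ray `kb`; this gives `z`. Distance from `c` increases away from `k`,
which puts `z` between `a` and `b`.

If `c` lies on `ab` this construction is meaningless, while laying off `cd` from `c` towards `b`
already gives the answer. A case-free term must combine the two. Write r = cd. On the ray `ba` take
`w` at distance bc - r from `b` and `g` at distance bc; beyond `w` mark off `u` with wu = wz and `e`
with we = cg, and take the one of `u`, `e` nearer to `b`. Off the line, triangle inequalities give
bw ≤ bz ≤ be, so `u = z` is chosen. On the line `g = c`, so `e = w` is chosen whatever `z` is. The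
nearer point is found without cases by going from the midpoint of `e` and `u` towards `b`. -/

namespace Geo

variable {P : Type u} [geoLang.Structure P]

namespace IsPlane

/-! ### Incidence and order -/

theorem B_symm (h : IsPlane P) {a b c : P} (hB : B a b c) : B c b a := h.between_symm _ _ _ hB

theorem B_ne₁₂ (h : IsPlane P) {a b c : P} (hB : B a b c) : a ≠ b := (h.between_ne _ _ _ hB).1

theorem B_ne₁₃ (h : IsPlane P) {a b c : P} (hB : B a b c) : a ≠ c := (h.between_ne _ _ _ hB).2

theorem B_ne₂₃ (h : IsPlane P) {a b c : P} (hB : B a b c) : b ≠ c :=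
  (h.B_ne₁₂ (h.B_symm hB)).symm

theorem NL_perm (h : IsPlane P) {a b c : P} (hL : NL a b c) :
    NL a c b ∧ NL b a c ∧ NL b c a ∧ NL c a b ∧ NL c b a := by
  have := h.between_symm
  unfold NL L at *
  grind

theorem NL_of_B (_h : IsPlane P) {a b c : P} (hB : B a b c) : NL a b c := Or.inl (Or.inl hB)

theorem T_iff (h : IsPlane P) {a b c : P} : T a b c ↔ ¬ NL a b c := by
  have := h.between_ne
  unfold T NL L
  grind

theorem NL_trans (h : IsPlane P) {a b c d : P} (hab : a ≠ b) (hc : NL a b c) (hd : NL a b d) :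
    NL a c d := by
  by_cases hcd : c = d
  · exact Or.inr (Or.inr (Or.inl hcd))
  · have h1 := h.unique_line a b c d hcd
    have h2 := h.NL_perm hc
    have h3 := h.NL_perm hd
    by_cases e1 : a = c
    · exact Or.inr (Or.inl e1)
    by_cases e2 : a = d
    · exact Or.inr (Or.inr (Or.inr e2))
    by_cases e3 : b = c
    · rwa [← e3]
    by_cases e4 : b = d
    · subst e4; exact h2.1
    exact Or.inl (h1 ⟨by unfold NL at hc; grind, by unfold NL at hd; grind⟩)

/-- Three points on the line `ab` are collinear. -/
theorem NL_line (h : IsPlane P) {a b c d e : P} (hab : a ≠ b) (hc : NL a b c) (hd : NL a b d)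
    (he : NL a b e) : NL c d e := by
  by_cases hac : a = c
  · subst hac; exact h.NL_trans hab hd he
  · exact h.NL_trans (Ne.symm hac) (h.NL_perm (h.NL_trans hab hc hd)).2.1
      (h.NL_perm (h.NL_trans hab hc he)).2.1

theorem exists_T (h : IsPlane P) {a b : P} (hab : a ≠ b) : ∃ p, T a b p := by
  by_contra hcon
  push Not at hcon
  have hN : ∀ p, NL a b p := fun p => by
    by_contra hp
    exact hcon p (h.T_iff.2 hp)
  exact h.T_iff.1 h.constants (h.NL_line hab (hN _) (hN _) (hN _))

end IsPlane

/-! ### The orientation sign -/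

open Classical in
/-- The orientation of `abc` relative to `αβγ`; it vanishes on collinear triples. -/
noncomputable def orient (a b c : P) : ℤ :=
  if T a b c then if SO (alpha P) (beta P) (gamma P) a b c then 1 else -1 else 0

namespace IsPlane

theorem SO_symm (h : IsPlane P) {a b c d e f : P} (hS : SO a b c d e f) : SO d e f a b c :=
  h.so_trans _ _ _ _ _ _ _ _ _ ⟨hS, h.so_refl _ _ _ (h.so_triangle _ _ _ _ _ _ hS).1⟩

theorem orient_ne_zero (_h : IsPlane P) {a b c : P} : orient a b c ≠ 0 ↔ T a b c := by
  unfold orient; split_ifs <;> simp_all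

theorem orient_eq_zero (h : IsPlane P) {a b c : P} : orient a b c = 0 ↔ NL a b c := by
  have := h.orient_ne_zero (a := a) (b := b) (c := c)
  have := h.T_iff (a := a) (b := b) (c := c)
  grind

/-- There are only two orientation classes, so comparison with the reference triangle decides
everything. -/
theorem SO_iff (h : IsPlane P) {a b c d e f : P} :
    SO a b c d e f ↔ orient a b c = orient d e f ∧ T a b c ∧ T d e f := by
  constructor
  · intro hS
    obtain ⟨h1, h2⟩ := h.so_triangle _ _ _ _ _ _ hS
    refine ⟨?_, h1, h2⟩
    have : SO (alpha P) (beta P) (gamma P) a b c ↔ SO (alpha P) (beta P) (gamma P) d e f :=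
      ⟨fun H => h.so_trans _ _ _ _ _ _ _ _ _ ⟨h.SO_symm H, hS⟩,
       fun H => h.so_trans _ _ _ _ _ _ _ _ _ ⟨h.SO_symm H, h.SO_symm hS⟩⟩
    unfold orient
    grind
  · rintro ⟨hs, h1, h2⟩
    unfold orient at hs
    by_cases H1 : SO (alpha P) (beta P) (gamma P) a b c <;>
    by_cases H2 : SO (alpha P) (beta P) (gamma P) d e f <;> simp [h1, h2, H1, H2] at hs
    · exact h.so_trans _ _ _ _ _ _ _ _ _ ⟨H1, H2⟩
    -- Both triangles are opposite to the reference triangle, hence alike.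
    · exact h.oo_oo_so _ _ _ _ _ _ _ _ _
        ⟨⟨fun H => H1 (h.SO_symm H), h1, h.constants⟩, ⟨H2, h.constants, h2⟩⟩

theorem OO_iff (h : IsPlane P) {a b c d e f : P} :
    OO a b c d e f ↔ orient a b c = - orient d e f ∧ T a b c ∧ T d e f := by
  unfold OO
  rw [h.SO_iff]
  unfold orient
  grind

theorem T_perm (h : IsPlane P) {a b c : P} (hT : T a b c) :
    T a c b ∧ T b a c ∧ T b c a ∧ T c a b ∧ T c b a := by
  simp only [h.T_iff] at *
  refine ⟨fun H => hT ?_, fun H => hT ?_, fun H => hT ?_, fun H => hT ?_, fun H => hT ?_⟩ <;>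
    have := h.NL_perm H <;> tauto

theorem orient_swap₁₂ (h : IsPlane P) (a b c : P) : orient b a c = - orient a b c := by
  by_cases hT : T a b c
  · have := (h.OO_iff.1 (h.oo_triangle a b c hT)).1
    omega
  · have h2 : ¬ T b a c := fun H => hT (h.T_perm H).2.1
    simp [orient, hT, h2]

theorem orient_swap₁₃ (h : IsPlane P) (a b c : P) : orient c b a = - orient a b c := by
  by_cases hT : T a b c
  · have := (h.OO_iff.1 (h.oo_reverse a b c hT)).1
    omega
  · have h2 : ¬ T c b a := fun H => hT (h.T_perm H).2.2.2.2
    simp [orient, hT, h2]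

theorem orient_perm (h : IsPlane P) (a b c : P) :
    orient b a c = - orient a b c ∧ orient c b a = - orient a b c ∧
    orient a c b = - orient a b c ∧ orient b c a = orient a b c ∧ orient c a b = orient a b c := by
  have h1 := h.orient_swap₁₂ a b c
  have h2 := h.orient_swap₁₃ a b c
  have h3 := h.orient_swap₁₂ c b a
  have h4 := h.orient_swap₁₃ b a c
  have h5 := h.orient_swap₁₂ c a b
  omega

/-- This is the sole bridge from betweenness to signs; together with antisymmetry it drives all the
order arguments below. A point `d` on the line makes all three signs vanish. -/
theorem orient_of_B (h : IsPlane P) {a b c : P} (hB : B a b c) (d : P) :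
    orient a c d = orient a b d ∧ orient b c d = orient a b d := by
  have hab := h.B_ne₁₂ hB
  have hac := h.B_ne₁₃ hB
  have hbc := h.B_ne₂₃ hB
  have hN := h.NL_of_B hB
  have hN' := h.NL_perm hN
  by_cases hT : T a b d
  · have hT2 : T a c d := h.T_iff.2 fun H => h.T_iff.1 hT (h.NL_trans hac hN'.1 H)
    have h1 := (h.SO_iff.1 (h.so_ray b a d c ⟨(h.T_perm hT).2.1, Or.inl hB⟩)).1
    have h2 := (h.OO_iff.1 (h.oo_of_between a b c d ⟨hB, hT2⟩)).1
    have h3 := h.orient_perm a b d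
    have h4 := h.orient_perm a c d
    have h5 := h.orient_perm b c d
    omega
  · have hd : NL a b d := by by_contra H; exact hT (h.T_iff.2 H)
    rw [h.orient_eq_zero.2 hd, h.orient_eq_zero, h.orient_eq_zero]
    exact ⟨h.NL_trans hab hN hd,
      h.NL_line hab (Or.inr (Or.inr (Or.inl rfl)) : NL a b b) hN hd⟩

/-- A segment whose ends lie on opposite sides of a line meets this line. -/
theorem exists_cross (h : IsPlane P) {a c b d : P} (ho : orient b d a = - orient b d c)
    (hT : T b d a) : ∃ x, NL b d x ∧ B a x c := by
  have h1 := h.orient_perm b d a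
  have h2 := h.orient_perm b d c
  have hT' := h.orient_ne_zero.2 hT
  have := h.crossbow a b c d (h.OO_iff.2 ⟨by omega, h.orient_ne_zero.1 (by omega),
    h.orient_ne_zero.1 (by omega)⟩)
  exact ⟨_, (h.NL_perm this.1).1, this.2⟩

/-- Converse to `orient_of_B`: seen from an outside point, the other two orders of `a`, `b`, `c`
would make the signs opposite, and coincidences would make them zero or opposite. -/
theorem B_of_orient (h : IsPlane P) {a b c p : P} (hL : NL a b c) (hT : T p a b)
    (ho : orient p a b = orient p b c) : B a b c := by
  have hne := h.orient_ne_zero.2 hT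
  have hbc : b ≠ c := by
    rintro rfl
    exact hne (by rw [ho, h.orient_eq_zero]; exact Or.inr (Or.inr (Or.inl rfl)))
  have hac : a ≠ c := by
    rintro rfl
    have := h.orient_perm p a b
    omega
  have q1 := h.orient_perm p a b
  have q2 := h.orient_perm p b c
  have q3 := h.orient_perm p a c
  rcases hL with (H | H | H) | H | H | H
  · exact H
  · have := h.orient_of_B H p
    have q2 := h.orient_perm p c b
    omega
  · have := h.orient_of_B H p
    have q2 := h.orient_perm p b a
    omega
  · exact absurd H hT.2.2.1
  · exact absurd H hbc
  · exact absurd H hac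

/-! ### Transitivity and connectivity of betweenness -/

theorem B_inner_trans (h : IsPlane P) {a b c d : P} (h1 : B a b c) (h2 : B a c d) :
    B b c d ∧ B a b d := by
  have hac := h.B_ne₁₃ h1
  have hab := h.B_ne₁₂ h1
  have n1 := (h.NL_perm (h.NL_of_B h1)).1
  have n2 := h.NL_of_B h2
  obtain ⟨p, hp⟩ := h.exists_T hab
  have hp0 := h.orient_ne_zero.2 hp
  have o1 := h.orient_of_B h1 p
  have o2 := h.orient_of_B h2 p
  have q1 := h.orient_perm a b p
  have q2 := h.orient_perm b c p
  have q3 := h.orient_perm c d p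
  have q4 := h.orient_perm b d p
  have hB : B b c d := h.B_of_orient (p := p)
    (h.NL_line hac n1 (by right; right; left; rfl) n2) (h.orient_ne_zero.1 (by grind)) (by grind)
  have o3 := h.orient_of_B hB p
  exact ⟨hB, h.B_of_orient (p := p) (h.NL_trans hac n1 n2) (h.orient_ne_zero.1 (by grind))
    (by grind)⟩

theorem B_outer_trans (h : IsPlane P) {a b c d : P} (h1 : B a b c) (h2 : B b c d) :
    B a b d ∧ B a c d := by
  have hbc := h.B_ne₂₃ h1
  have hab := h.B_ne₁₂ h1
  have n1 := (h.NL_perm (h.NL_of_B h1)).2.2.1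
  have n2 := h.NL_of_B h2
  obtain ⟨p, hp⟩ := h.exists_T hab
  have hp0 := h.orient_ne_zero.2 hp
  have o1 := h.orient_of_B h1 p
  have o2 := h.orient_of_B h2 p
  have q1 := h.orient_perm a b p
  have q2 := h.orient_perm b c p
  have q3 := h.orient_perm c d p
  have q4 := h.orient_perm b d p
  have q5 := h.orient_perm a c p
  have nb : NL b c b := by right; right; right; rfl
  have nc : NL b c c := by right; right; left; rfl
  exact ⟨h.B_of_orient (p := p) (h.NL_line hbc n1 nb n2) (h.orient_ne_zero.1 (by grind))
    (by grind), h.B_of_orient (p := p) (h.NL_line hbc n1 nc n2) (h.orient_ne_zero.1 (by grind))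
    (by grind)⟩

theorem B_or_of_extend (h : IsPlane P) {a b c d : P} (h1 : B a b c) (h2 : B a b d) :
    c = d ∨ B b c d ∨ B b d c := by
  by_cases hcd : c = d
  · exact Or.inl hcd
  have hab := h.B_ne₁₂ h1
  obtain ⟨p, hp⟩ := h.exists_T hab
  have hp0 := h.orient_ne_zero.2 hp
  have o1 := h.orient_of_B h1 p
  have o2 := h.orient_of_B h2 p
  have q := h.orient_perm b c p
  have nb : NL a b b := by right; right; left; rfl
  rcases h.NL_line hab nb (h.NL_of_B h1) (h.NL_of_B h2) with (H | H | H) | H | H | H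
  · exact Or.inr (Or.inl H)
  · exact Or.inr (Or.inr H)
  · have := h.orient_of_B H p
    omega
  · exact absurd H (h.B_ne₂₃ h1)
  · exact Or.inl H
  · exact absurd H (h.B_ne₂₃ h2)

theorem B_or_of_within (h : IsPlane P) {a b c d : P} (h1 : B a b d) (h2 : B a c d) :
    b = c ∨ B a b c ∨ B a c b := by
  by_cases hcd : b = c
  · exact Or.inl hcd
  have had := h.B_ne₁₃ h1
  obtain ⟨p, hp⟩ := h.exists_T had
  have hp0 := h.orient_ne_zero.2 hp
  have o1 := h.orient_of_B h1 p
  have o2 := h.orient_of_B h2 p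
  have q := h.orient_perm b a p
  rcases h.NL_trans had (h.NL_perm (h.NL_of_B h1)).1 (h.NL_perm (h.NL_of_B h2)).1
    with (H | H | H) | H | H | H
  · exact Or.inr (Or.inl H)
  · exact Or.inr (Or.inr H)
  · have := h.orient_of_B H p
    omega
  · exact absurd H (h.B_ne₁₂ h1)
  · exact Or.inl H
  · exact absurd H (h.B_ne₁₂ h2)

end IsPlane

/-- `y` lies on the open ray from `o` through `x`. -/
def OnRay (o x y : P) : Prop := o ≠ x ∧ (B o x y ∨ B o y x ∨ x = y)

/-! ### Rays -/

namespace IsPlane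

theorem OnRay.symm (h : IsPlane P) {o x y : P} (hr : OnRay o x y) : OnRay o y x := by
  obtain ⟨h1, h2⟩ := hr
  have := @h.B_ne₁₂
  have := @h.B_ne₁₃
  unfold OnRay
  grind

theorem OnRay.SD (_h : IsPlane P) {o x y : P} (hr : OnRay o x y) : SD o x y := by
  obtain ⟨h1, h2⟩ := hr
  unfold Geo.SD
  grind

theorem OnRay.orient (h : IsPlane P) {o x y : P} (hr : OnRay o x y) (p : P) :
    orient o y p = orient o x p := by
  rcases hr.2 with H | H | H
  · exact (h.orient_of_B H p).1
  · exact (h.orient_of_B H p).1.symm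
  · rw [H]

theorem OnRay.NL (h : IsPlane P) {o x y : P} (hr : OnRay o x y) : NL o x y := by
  rcases hr.2 with H | H | H
  · exact h.NL_of_B H
  · exact (h.NL_perm (h.NL_of_B H)).1
  · exact Or.inr (Or.inr (Or.inl H))

theorem OnRay.ne (h : IsPlane P) {o x y : P} (hr : OnRay o x y) : o ≠ y :=
  (OnRay.symm h hr).1

/-- A point `q` on the opposite ray replaces the three cases of `OnRay` by a single betweenness,
which is the form that segment extension produces. -/
theorem onRay_iff_B (h : IsPlane P) {q o x y : P} (hB : B q o x) : OnRay o x y ↔ B q o y := by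
  constructor
  · rintro ⟨_, H | H | H⟩
    · exact (h.B_outer_trans hB H).1
    · exact h.B_symm (h.B_inner_trans (h.B_symm H) (h.B_symm hB)).1
    · rwa [← H]
  · intro H
    have := h.B_or_of_extend hB H
    exact ⟨h.B_ne₂₃ hB, by tauto⟩

theorem onRay_of_NL_of_orient (h : IsPlane P) {o x y p : P} (hN : Geo.NL o x y) (hT : T o x p)
    (ho : Geo.orient o y p = Geo.orient o x p) : OnRay o x y := by
  have hne := h.orient_ne_zero.2 hT
  refine ⟨hT.2.1, ?_⟩
  rcases hN with (H | H | H) | H | H | H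
  · exact Or.inl H
  · exact Or.inr (Or.inl H)
  · have := h.orient_of_B H p
    have := h.orient_perm o x p
    omega
  · exact absurd H hT.2.1
  · exact Or.inr (Or.inr H)
  · subst H
    exact absurd (h.orient_eq_zero.2 (Or.inr (Or.inl rfl))) (by omega : ¬ Geo.orient o o p = 0)

/-! ### Lengths -/

theorem C_symm (h : IsPlane P) {a b c d : P} (hC : C a b c d) : C c d a b :=
  h.seg_trans _ _ _ _ _ _ ⟨hC, (h.seg_refl a b).1⟩

theorem C_trans (h : IsPlane P) {a b c d e f : P} (h1 : C a b c d) (h2 : C c d e f) : C a b e f :=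
  h.seg_trans _ _ _ _ _ _ ⟨h.C_symm h1, h2⟩

theorem exists_ne (h : IsPlane P) (a : P) : ∃ b, b ≠ a := by
  by_cases hb : alpha P = a
  · exact ⟨beta P, fun H => h.constants.2.1 (hb.trans H.symm)⟩
  · exact ⟨_, hb⟩

theorem eq_of_C_null (h : IsPlane P) {a b c : P} (hC : C a b c c) : a = b := by
  by_contra hne
  obtain ⟨q, hq⟩ := h.exists_ne c
  have h1 := h.ext_cong q c a b hq
  have h2 := h.ext_between q c a b ⟨hq, hne⟩
  -- The extension of `qc` by a null segment is unique, but both `c` and the extension by `ab`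
  -- qualify.
  have h3 := h.ext_unique q c c c _ ⟨Or.inl h2, h.C_trans h1 hC⟩
  have h4 := h.ext_unique q c c c c ⟨Or.inr rfl, (h.seg_refl c c).1⟩
  exact h.B_ne₂₃ h2 (h4.trans h3.symm)

theorem ext_null (h : IsPlane P) {a b : P} (c : P) (hab : a ≠ b) : ext a b c c = b :=
  (h.eq_of_C_null (h.ext_cong a b c c hab)).symm

theorem ext_eq_or_B (h : IsPlane P) {a b : P} (c d : P) (hab : a ≠ b) :
    ext a b c d = b ∨ B a b (ext a b c d) := by
  by_cases hcd : c = d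
  · subst hcd; exact Or.inl (h.ext_null c hab)
  · exact Or.inr (h.ext_between _ _ _ _ ⟨hab, hcd⟩)

theorem ext_congr (h : IsPlane P) {a b c d e f : P} (hab : a ≠ b) (hC : C c d e f) :
    ext a b c d = ext a b e f := by
  refine h.ext_unique _ _ _ _ _ ⟨?_, h.C_trans (h.ext_cong a b c d hab) hC⟩
  rcases h.ext_eq_or_B c d hab with H | H
  · exact Or.inr H.symm
  · exact Or.inl H

theorem beta_ne_alpha (h : IsPlane P) : beta P ≠ alpha P := h.constants.2.1.symm

end IsPlane

/-- Lengths, represented by the points of the closed ray from `α` away from `β`. -/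
def Len (_h : IsPlane P) : Type u := {x : P // x = alpha P ∨ B (beta P) (alpha P) x}

/-! ### The ordered monoid of lengths -/

namespace IsPlane

/-- The length of the segment `ab`. -/
noncomputable def dist (h : IsPlane P) (a b : P) : Len h :=
  ⟨ext (beta P) (alpha P) a b, h.ext_eq_or_B a b h.beta_ne_alpha⟩

theorem dist_eq_iff (h : IsPlane P) {a b c d : P} : h.dist a b = h.dist c d ↔ C a b c d := by
  constructor
  · intro H
    have H' : ext (beta P) (alpha P) a b = ext (beta P) (alpha P) c d := congrArg Subtype.val H
    have h1 := h.ext_cong _ _ a b h.beta_ne_alpha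
    have h2 := h.ext_cong _ _ c d h.beta_ne_alpha
    rw [← H'] at h2
    exact h.C_trans (h.C_symm h1) h2
  · intro H
    exact Subtype.ext (h.ext_congr h.beta_ne_alpha H)

theorem dist_comm (h : IsPlane P) (a b : P) : h.dist a b = h.dist b a :=
  h.dist_eq_iff.2 (h.seg_refl a b).2

theorem dist_alpha (h : IsPlane P) (x : Len h) : h.dist (alpha P) x.1 = x := by
  refine Subtype.ext (h.ext_unique _ _ _ _ _ ⟨?_, (h.seg_refl _ _).1⟩).symm
  rcases x.2 with H | H
  · exact Or.inr H.symm
  · exact Or.inl H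

theorem dist_ext (h : IsPlane P) {a b : P} (hab : a ≠ b) (c d : P) :
    h.dist b (ext a b c d) = h.dist c d :=
  h.dist_eq_iff.2 (h.ext_cong a b c d hab)

theorem eq_ext (h : IsPlane P) {a b c d x : P} (hB : B a b x ∨ b = x)
    (hd : h.dist b x = h.dist c d) : x = ext a b c d :=
  h.ext_unique _ _ _ _ _ ⟨hB, h.dist_eq_iff.1 hd⟩

noncomputable instance (h : IsPlane P) : Zero (Len h) := ⟨⟨alpha P, Or.inl rfl⟩⟩

theorem beta_ne_len (h : IsPlane P) (x : Len h) : beta P ≠ x.1 := by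
  rcases x.2 with H | H
  · rw [H]; exact h.beta_ne_alpha
  · exact h.B_ne₁₃ H

theorem B_beta_trans (h : IsPlane P) (x : Len h) {y : P} (hy : B (beta P) x.1 y) :
    B (beta P) (alpha P) y ∧ (x = 0 ∨ B (alpha P) x.1 y) := by
  rcases x.2 with H | H
  · rw [H] at hy
    exact ⟨hy, Or.inl (Subtype.ext H)⟩
  · have := h.B_inner_trans H hy
    exact ⟨this.2, Or.inr this.1⟩

noncomputable instance (h : IsPlane P) : Add (Len h) :=
  ⟨fun x y => ⟨ext (beta P) x.1 (alpha P) y.1, by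
    rcases h.ext_eq_or_B (alpha P) y.1 (h.beta_ne_len x) with H | H
    · rw [H]; exact x.2
    · exact Or.inr (h.B_beta_trans x H).1⟩⟩

theorem len_zero_val (h : IsPlane P) : (0 : Len h).1 = alpha P := rfl

theorem dist_self (h : IsPlane P) (a : P) : h.dist a a = 0 :=
  Subtype.ext (h.ext_null a h.beta_ne_alpha)

theorem dist_eq_zero (h : IsPlane P) {a b : P} : h.dist a b = 0 ↔ a = b := by
  constructor
  · intro H
    rw [← h.dist_self a, h.dist_eq_iff] at H
    exact h.eq_of_C_null H
  · rintro rfl; exact h.dist_self a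

theorem dist_len_add (h : IsPlane P) (x y : Len h) : h.dist x.1 (x + y).1 = y := by
  have := h.dist_ext (h.beta_ne_len x) (alpha P) y.1
  rw [h.dist_alpha] at this
  exact this

protected theorem len_add_zero (h : IsPlane P) (x : Len h) : x + 0 = x :=
  Subtype.ext (h.ext_null _ (h.beta_ne_len x))

theorem len_eq_zero_iff (h : IsPlane P) {x : Len h} : x = 0 ↔ x.1 = alpha P :=
  ⟨fun H => congrArg Subtype.val H, fun H => Subtype.ext H⟩

theorem B_beta_add (h : IsPlane P) (x : Len h) {y : Len h} (hy : y ≠ 0) :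
    B (beta P) x.1 (x + y).1 :=
  h.ext_between _ _ _ _ ⟨h.beta_ne_len x, fun H => hy (h.len_eq_zero_iff.2 H.symm)⟩

theorem B_alpha_add (h : IsPlane P) {x y : Len h} (hx : x ≠ 0) (hy : y ≠ 0) :
    B (alpha P) x.1 (x + y).1 :=
  (h.B_beta_trans x (h.B_beta_add x hy)).2.resolve_left hx

protected theorem len_zero_add (h : IsPlane P) (x : Len h) : 0 + x = x := by
  have h1 := h.dist_len_add 0 x
  rw [h.len_zero_val, h.dist_alpha] at h1
  exact h1

/-- Lengths of adjacent segments add up. -/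
theorem dist_add (h : IsPlane P) {a b c : P} (hB : B a b c) :
    h.dist a b + h.dist b c = h.dist a c := by
  have hx : h.dist a b ≠ 0 := fun H => h.B_ne₁₂ hB (h.dist_eq_zero.1 H)
  have hy : h.dist b c ≠ 0 := fun H => h.B_ne₂₃ hB (h.dist_eq_zero.1 H)
  have h1 := h.B_alpha_add hx hy
  have h2 := h.dist_len_add (h.dist a b) (h.dist b c)
  have h3 := h.dist_alpha (h.dist a b)
  have h4 := h.seg_add _ _ _ _ _ _ ⟨hB, h1, h.dist_eq_iff.1 h3.symm, h.dist_eq_iff.1 h2.symm⟩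
  rw [← h.dist_alpha (h.dist a b + h.dist b c)]
  exact (h.dist_eq_iff.2 h4).symm

protected theorem len_add_comm (h : IsPlane P) (x y : Len h) : x + y = y + x := by
  by_cases hx : x = 0
  · rw [hx, h.len_zero_add, h.len_add_zero]
  by_cases hy : y = 0
  · rw [hy, h.len_zero_add, h.len_add_zero]
  -- The segment from `α` to `y + x`, read backwards, is `x` followed by `y`.
  have h1 := h.dist_add (h.B_symm (h.B_alpha_add hy hx))
  rwa [h.dist_comm _ y.1, h.dist_len_add, h.dist_comm y.1, h.dist_alpha, h.dist_comm,
    h.dist_alpha] at h1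

protected theorem len_add_assoc (h : IsPlane P) (x y z : Len h) : x + y + z = x + (y + z) := by
  by_cases hx : x = 0
  · rw [hx, h.len_zero_add, h.len_zero_add]
  by_cases hy : y = 0
  · rw [hy, h.len_zero_add, h.len_add_zero]
  by_cases hz : z = 0
  · rw [hz, h.len_add_zero, h.len_add_zero]
  have h1 := h.B_beta_add x hy
  have h2 := h.B_beta_add (x + y) hz
  have h3 := h.B_inner_trans h1 h2
  have h4 := h.dist_add h3.1
  rw [h.dist_len_add, h.dist_len_add] at h4
  refine Subtype.ext (h.eq_ext (Or.inl h3.2) ?_)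
  rw [h.dist_alpha, ← h4]

noncomputable instance (h : IsPlane P) : AddCommMonoid (Len h) where
  add_assoc := h.len_add_assoc
  zero_add := h.len_zero_add
  add_zero := h.len_add_zero
  add_comm := h.len_add_comm
  nsmul := nsmulRec

theorem len_add_left_cancel (h : IsPlane P) {x y z : Len h} (H : x + y = x + z) : y = z := by
  rw [← h.dist_len_add x y, H, h.dist_len_add]

theorem len_eq_zero_of_add (h : IsPlane P) {x y : Len h} (H : x + y = 0) : x = 0 := by
  by_contra hx
  by_cases hy : y = 0
  · rw [hy, add_zero] at H; exact hx H
  have := h.B_alpha_add hx hy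
  rw [H] at this
  exact h.B_ne₁₃ this rfl

theorem len_total (h : IsPlane P) (x y : Len h) : (∃ z, y = x + z) ∨ ∃ z, x = y + z := by
  have key : ∀ x y : Len h, B (alpha P) x.1 y.1 → ∃ z, y = x + z := fun x y H => by
    have := h.dist_add H
    rw [h.dist_alpha, h.dist_alpha] at this
    exact ⟨_, this.symm⟩
  by_cases hx : x = 0
  · exact Or.inl ⟨y, by rw [hx, zero_add]⟩
  by_cases hy : y = 0
  · exact Or.inr ⟨x, by rw [hy, zero_add]⟩
  have hx' := x.2.resolve_left fun H => hx (h.len_eq_zero_iff.2 H)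
  have hy' := y.2.resolve_left fun H => hy (h.len_eq_zero_iff.2 H)
  rcases h.B_or_of_extend hx' hy' with H | H | H
  · exact Or.inl ⟨0, by rw [add_zero]; exact (Subtype.ext H).symm⟩
  · exact Or.inl (key _ _ H)
  · exact Or.inr (key _ _ H)

open Classical in
noncomputable instance (h : IsPlane P) : LinearOrder (Len h) where
  le x y := ∃ z, y = x + z
  le_refl x := ⟨0, (add_zero x).symm⟩
  le_trans := by
    rintro x y z ⟨u, rfl⟩ ⟨v, rfl⟩
    exact ⟨u + v, by rw [add_assoc]⟩
  le_antisymm := by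
    rintro x y ⟨u, rfl⟩ ⟨v, hv⟩
    have : u + v = 0 := h.len_add_left_cancel (x := x) (by rw [← add_assoc, ← hv, add_zero])
    rw [h.len_eq_zero_of_add this, add_zero]
  le_total := h.len_total
  toDecidableLE := Classical.decRel _

instance (h : IsPlane P) : IsOrderedCancelAddMonoid (Len h) where
  add_le_add_left := by
    rintro x y ⟨z, rfl⟩ w
    exact ⟨z, by rw [add_right_comm]⟩
  le_of_add_le_add_left := by
    rintro x y z ⟨w, hw⟩
    exact ⟨w, h.len_add_left_cancel (x := x) (by rw [hw, add_assoc])⟩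

theorem len_nonneg (h : IsPlane P) (x : Len h) : 0 ≤ x := ⟨x, (zero_add x).symm⟩

theorem dist_pos (h : IsPlane P) {a b : P} : 0 < h.dist a b ↔ a ≠ b := by
  rw [lt_iff_le_and_ne]
  exact ⟨fun H e => H.2 (h.dist_eq_zero.2 e).symm,
    fun H => ⟨h.len_nonneg _, fun e => H (h.dist_eq_zero.1 e.symm)⟩⟩

/-! ### Laying off lengths -/

theorem dist_lt_of_B (h : IsPlane P) {a b c : P} (hB : B a b c) :
    h.dist a b < h.dist a c ∧ h.dist b c < h.dist a c := by
  have h1 := h.dist_add hB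
  have h2 := h.dist_pos.2 (h.B_ne₁₂ hB)
  have h3 := h.dist_pos.2 (h.B_ne₂₃ hB)
  grind

theorem exists_opposite (h : IsPlane P) {a b : P} (hab : a ≠ b) : B a b (ext a b a b) :=
  h.ext_between _ _ _ _ ⟨hab, hab⟩

theorem B_of_onRay_of_lt (h : IsPlane P) {o x y : P} (hr : OnRay o x y)
    (hd : h.dist o x < h.dist o y) : B o x y := by
  rcases hr.2 with H | H | H
  · exact H
  · exact absurd hd (h.dist_lt_of_B H).1.le.not_gt
  · rw [H] at hd; exact absurd hd (lt_irrefl _)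

theorem onRay_trans (h : IsPlane P) {o x y z : P} (h1 : OnRay o x y) (h2 : OnRay o x z) :
    OnRay o y z := by
  have hB := h.B_symm (h.exists_opposite h1.1.symm)
  have h3 := (h.onRay_iff_B hB).1 h1
  exact (h.onRay_iff_B h3).2 ((h.onRay_iff_B hB).1 h2)

/-- The ray from `o` through `x` contains a point at any positive distance from `o`. -/
theorem layoff (h : IsPlane P) {o x c d : P} (hox : o ≠ x) (hcd : c ≠ d) :
    OnRay o x (ext (ext x o x o) o c d) ∧ h.dist o (ext (ext x o x o) o c d) = h.dist c d := by
  have hB := h.B_symm (h.exists_opposite hox.symm)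
  exact ⟨(h.onRay_iff_B hB).2 (h.ext_between _ _ _ _ ⟨h.B_ne₁₂ hB, hcd⟩),
    h.dist_ext (h.B_ne₁₂ hB) c d⟩

theorem doub_of_ne (_h : IsPlane P) {a b : P} (hab : a ≠ b) : doub a b = ext a b a b := by
  simp [doub, hab]

theorem segLT_iff (h : IsPlane P) {a b c d : P} : SegLT a b c d ↔ h.dist a b < h.dist c d := by
  unfold SegLT lf
  constructor
  · rintro (H | ⟨rfl, H⟩)
    · have hcd := h.B_ne₁₃ H
      rw [h.doub_of_ne hcd.symm] at H
      have h1 := h.dist_ext (h.B_ne₂₃ (h.exists_opposite hcd.symm)).symm a b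
      rw [← h1]
      exact (h.dist_lt_of_B H).1
    · rw [h.dist_self]; exact h.dist_pos.2 H
  · intro H
    have hcd : c ≠ d := fun e => by
      rw [e, h.dist_self] at H
      exact absurd H (h.len_nonneg _).not_gt
    by_cases hab : a = b
    · exact Or.inr ⟨hab, hcd⟩
    rw [h.doub_of_ne hcd.symm]
    obtain ⟨h1, h2⟩ := h.layoff hcd hab
    exact Or.inl (h.B_of_onRay_of_lt (OnRay.symm h h1) (by rwa [h2]))

theorem mid_unique (h : IsPlane P) {a b m : P} (hB : B a m b) (hd : h.dist a m = h.dist m b) :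
    m = mid a b := by
  have hab := h.B_ne₁₃ hB
  obtain ⟨h1, h2⟩ := h.mid_spec a b hab
  have h2 := h.dist_eq_iff.2 h2
  have e1 := h.dist_add hB
  have e2 := h.dist_add h1
  have e3 := h.dist_comm (mid a b) b
  rcases h.B_or_of_within hB h1 with H | H | H
  · exact H
  · have := h.dist_lt_of_B H
    have := h.dist_lt_of_B (h.B_inner_trans H h1).1
    grind
  · have := h.dist_lt_of_B H
    have := h.dist_lt_of_B (h.B_inner_trans H hB).1
    grind

/-! ### Angles -/

theorem AC_symm (h : IsPlane P) {a b c d e f : P} (hA : AC a b c d e f) : AC d e f a b c :=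
  h.ang_trans _ _ _ _ _ _ _ _ _
    ⟨hA, (h.ang_refl _ _ _ (h.ang_triangle _ _ _ _ _ _ hA).1).1⟩

theorem AC_trans (h : IsPlane P) {a b c d e f i j k : P} (h1 : AC a b c d e f)
    (h2 : AC d e f i j k) : AC a b c i j k :=
  h.ang_trans _ _ _ _ _ _ _ _ _ ⟨h.AC_symm h1, h2⟩

theorem AC_flip_left (h : IsPlane P) {a b c d e f : P} (hA : AC a b c d e f) : AC c b a d e f :=
  h.ang_trans _ _ _ _ _ _ _ _ _
    ⟨(h.ang_refl _ _ _ (h.ang_triangle _ _ _ _ _ _ hA).1).2, hA⟩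

theorem AC_flip (h : IsPlane P) {a b c d e f : P} (hA : AC a b c d e f) : AC c b a f e d :=
  h.AC_flip_left (h.AC_symm (h.AC_flip_left (h.AC_symm hA)))

theorem T_of_onRay (h : IsPlane P) {a b c d : P} (hT : T a b c) (hr : OnRay b c d) : T a b d := by
  have h1 := OnRay.orient h hr a
  have h2 := h.orient_ne_zero.2 hT
  have h3 := h.orient_perm b c a
  have h4 := h.orient_perm b d a
  exact h.orient_ne_zero.1 (by omega)

theorem AC_ray_right (h : IsPlane P) {a b c d e f c' : P} (hA : AC a b c d e f)
    (hr : OnRay b c c') : AC a b c' d e f :=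
  h.AC_trans (h.AC_symm (h.ang_ray _ _ _ _
    ⟨OnRay.SD h hr, (h.ang_triangle _ _ _ _ _ _ hA).1⟩)) hA

theorem AC_ray_left (h : IsPlane P) {a b c d e f a' : P} (hA : AC a b c d e f)
    (hr : OnRay b a a') : AC a' b c d e f :=
  h.AC_flip_left (h.AC_ray_right (h.AC_flip_left hA) hr)

theorem eq_of_onRay_onRay (h : IsPlane P) {d e f x : P} (hT : T d e f) (h1 : OnRay d f x)
    (h2 : OnRay e f x) : f = x := by
  by_contra hfx
  have n1 := (h.NL_perm (OnRay.NL h h1)).2.2.1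
  have n2 := (h.NL_perm (OnRay.NL h h2)).2.2.1
  have n3 : NL f x f := Or.inr (Or.inr (Or.inr rfl))
  exact h.T_iff.1 hT (h.NL_line hfx n1 n2 n3)

/-- An angle can be transported to a given side of a given ray in only one way. -/
theorem onRay_of_AC (h : IsPlane P) {a b c d e x y : P} (hx : AC a b c d e x)
    (hy : AC a b c d e y) (ho : orient d e x = orient d e y) : OnRay e x y := by
  have hT := (h.ang_triangle _ _ _ _ _ _ hx).1
  have hTx := (h.ang_triangle _ _ _ _ _ _ hx).2
  have hTy := (h.ang_triangle _ _ _ _ _ _ hy).2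
  -- After laying off the length `bc`, the points of both rays satisfy the characterization of the
  -- same transported point.
  have key : ∀ z, AC a b c d e z → orient d e z = orient d e y →
      ∃ w, OnRay e z w ∧ w = ats a b c d e y := fun z hz hoz => by
    have hTz := (h.ang_triangle _ _ _ _ _ _ hz).2
    obtain ⟨r1, r2⟩ := h.layoff hTz.2.2.1 hT.2.2.1
    refine ⟨_, r1, h.ats_unique _ _ _ _ _ _ _
      ⟨h.AC_symm (h.AC_ray_right (h.AC_symm hz) r1), ?_, (h.dist_eq_iff.1 r2.symm)⟩⟩
    refine h.SO_iff.2 ⟨?_, hTy, h.T_of_onRay hTz r1⟩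
    have q1 := h.orient_perm d e z
    have q2 := OnRay.orient h r1 d
    have q3 := h.orient_perm d e (ext (ext z e z e) e b c)
    omega
  obtain ⟨w1, r1, e1⟩ := key x hx ho
  obtain ⟨w2, r2, e2⟩ := key y hy rfl
  rw [e1, ← e2] at r1
  exact h.onRay_trans (OnRay.symm h r1) (OnRay.symm h r2)

/-- Side-angle-side. -/
theorem SAS (h : IsPlane P) {a b c d e f : P} (hA : AC a b c d e f)
    (h1 : h.dist a b = h.dist d e) (h2 : h.dist b c = h.dist e f) :
    h.dist a c = h.dist d f ∧ AC b a c e d f ∧ AC b c a e f d := by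
  obtain ⟨hT, hT'⟩ := h.ang_triangle _ _ _ _ _ _ hA
  have h1' : h.dist b a = h.dist e d := by rw [h.dist_comm, h1, h.dist_comm]
  have hS : AC b a c e d f := h.side_angle_side _ _ _ _ _ _ ⟨(h.T_perm hT).2.1, (h.T_perm hT').2.1,
    h.dist_eq_iff.1 h1', h.dist_eq_iff.1 h2, hA⟩
  have hS' : AC b c a e f d := h.side_angle_side _ _ _ _ _ _ ⟨(h.T_perm hT).2.2.1,
    (h.T_perm hT').2.2.1, h.dist_eq_iff.1 h2, h.dist_eq_iff.1 h1', h.AC_flip hA⟩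
  refine ⟨?_, hS, hS'⟩
  -- The axiom yields angles only. For the third side, lay off `ac` on the ray `df`; its end `x`
  -- also spans the given angle at `e`, so uniqueness of angle transport forces `x = f`.
  obtain ⟨r1, r2⟩ := h.layoff hT'.2.2.2 hT.2.2.2
  set x := ext (ext f d f d) d a c
  have hS2 := h.AC_symm (h.AC_ray_right (h.AC_symm hS) r1)
  have hTx := h.ang_triangle _ _ _ _ _ _ hS2
  have hA2 : AC a b c d e x := h.side_angle_side _ _ _ _ _ _ ⟨hT, (h.T_perm hTx.2).2.1,
    h.dist_eq_iff.1 h1, h.dist_eq_iff.1 r2.symm, hS2⟩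
  have q1 := OnRay.orient h r1 e
  have q2 := h.orient_perm d f e
  have q3 := h.orient_perm d x e
  have r3 := h.onRay_of_AC hA hA2 (by omega)
  rw [h.eq_of_onRay_onRay hT' r1 r3, r2]

/-- Pappus' argument: side-angle-side applied to the triangle and itself with `b` and `c` exchanged.
-/
theorem isosceles (h : IsPlane P) {a b c : P} (hT : T a b c) (hd : h.dist a b = h.dist a c) :
    AC a b c a c b :=
  (h.SAS (h.ang_refl _ _ _ (h.T_perm hT).2.1).2 (by rw [h.dist_comm, hd, h.dist_comm]) (by
    rw [← hd, h.dist_comm])).2.1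

/-- Supplements of congruent angles are congruent. -/
theorem AC_supplement (h : IsPlane P) {a b c c' d e f f' : P} (hA : AC a b c d e f)
    (hB : B c b c') (hB' : B f e f') : AC a b c' d e f' := by
  obtain ⟨hT, hT'⟩ := h.ang_triangle _ _ _ _ _ _ hA
  -- normalize the lengths of the sides
  obtain ⟨r1, l1⟩ := h.layoff hT'.2.1.symm hT.2.1
  obtain ⟨r2, l2⟩ := h.layoff hT'.2.2.1 hT.2.2.1
  obtain ⟨r3, l3⟩ := h.layoff (h.B_ne₂₃ hB') (h.B_ne₂₃ hB)
  set d₁ := ext (ext d e d e) e a b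
  set f₁ := ext (ext f e f e) e b c
  set f₂ := ext (ext f' e f' e) e b c'
  have hB1 : B f₁ e f₂ := h.B_symm ((h.onRay_iff_B (h.B_symm ((h.onRay_iff_B hB').1 r3))).1 r2)
  have hA1 : AC a b c d₁ e f₁ :=
    h.AC_symm (h.AC_ray_left (h.AC_ray_right (h.AC_symm hA) r2) r1)
  -- Side-angle-side is applied in turn to the triangles `abc`, `acc'` and `bc'a` and their
  -- counterparts; the last one contains the supplement at `b`.
  obtain ⟨s1, -, s2⟩ := h.SAS hA1 (l1.symm.trans (h.dist_comm _ _)) l2.symm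
  have ray1 : OnRay c b c' := ⟨h.B_ne₁₂ hB, Or.inl hB⟩
  have ray2 : OnRay f₁ e f₂ := ⟨h.B_ne₁₂ hB1, Or.inl hB1⟩
  have s3 : AC a c c' d₁ f₁ f₂ :=
    h.AC_symm (h.AC_ray_right (h.AC_symm (h.AC_ray_right (h.AC_flip s2) ray1)) ray2)
  have hcc : h.dist c c' = h.dist f₁ f₂ := by
    rw [← h.dist_add hB, ← h.dist_add hB1, l3, h.dist_comm f₁, l2, h.dist_comm b c]
  obtain ⟨s4, -, s5⟩ := h.SAS s3 s1 hcc
  have ray3 : OnRay c' c b := ⟨(h.B_ne₁₃ hB).symm, Or.inr (Or.inl (h.B_symm hB))⟩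
  have ray4 : OnRay f₂ f₁ e := ⟨(h.B_ne₁₃ hB1).symm, Or.inr (Or.inl (h.B_symm hB1))⟩
  have s6 : AC b c' a e f₂ d₁ :=
    h.AC_symm (h.AC_ray_left (h.AC_symm (h.AC_ray_left s5 ray3)) ray4)
  obtain ⟨-, s7, -⟩ := h.SAS s6 l3.symm (by rw [h.dist_comm, s4, h.dist_comm])
  exact h.AC_symm (h.AC_ray_left (h.AC_ray_right (h.AC_symm (h.AC_flip s7)) (OnRay.symm h r3))
    (OnRay.symm h r1))

/-- Both angles are supplements of `abc'`. -/
theorem AC_vertical (h : IsPlane P) {a b c a' c' : P} (hT : T a b c) (hB : B a b a')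
    (hB' : B c b c') : AC a b c a' b c' := by
  have ray : T a b c' := by
    have h1 := h.orient_of_B hB' a
    have h2 := h.orient_ne_zero.2 hT
    have h3 := h.orient_perm a b c
    have h4 := h.orient_perm b c' a
    have h5 := h.orient_perm c b a
    exact h.orient_ne_zero.1 (by omega)
  exact h.AC_symm (h.AC_flip_left (h.AC_symm
    (h.AC_supplement (h.ang_refl _ _ _ ray).2 (h.B_symm hB') hB)))

end IsPlane

/-- The angle `abc` is smaller than the angle `def`. -/
def AngLT (a b c d e f : P) : Prop := ∃ x, B d x f ∧ AC a b c d e x ∧ T d e f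

/-! ### Comparison of angles -/

namespace IsPlane

theorem T_of_B (h : IsPlane P) {d e f x : P} (hT : T d e f) (hB : B d x f) : T d e x := by
  have h1 := h.orient_of_B hB e
  have h2 := h.orient_ne_zero.2 hT
  have h3 := h.orient_perm d e f
  have h4 := h.orient_perm d e x
  have h5 := h.orient_perm d x e
  have h6 := h.orient_perm d f e
  exact h.orient_ne_zero.1 (by omega)

theorem AngLT_of_B (h : IsPlane P) {d e f x : P} (hT : T d e f) (hB : B d x f) :
    AngLT d e x d e f :=
  ⟨x, hB, (h.ang_refl _ _ _ (h.T_of_B hT hB)).1, hT⟩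

theorem AngLT_congr_left (h : IsPlane P) {a b c a' b' c' d e f : P} (hA : AC a' b' c' a b c)
    (hL : AngLT a b c d e f) : AngLT a' b' c' d e f := by
  obtain ⟨x, h1, h2, h3⟩ := hL
  exact ⟨x, h1, h.AC_trans hA h2, h3⟩

/-- By uniqueness of transport the witness would lie on the ray `ef` as well as on the ray `df`,
hence equal `f`. -/
theorem not_AngLT_of_AC (h : IsPlane P) {a b c d e f : P} (hA : AC a b c d e f) :
    ¬ AngLT a b c d e f := by
  rintro ⟨x, h1, h2, hT⟩
  have q1 := h.orient_of_B h1 e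
  have q2 := h.orient_perm d x e
  have q3 := h.orient_perm d f e
  have r := h.onRay_of_AC hA h2 (by omega)
  have r2 : OnRay d f x := ⟨h.B_ne₁₃ h1, Or.inr (Or.inl h1)⟩
  exact h.B_ne₂₃ h1 (h.eq_of_onRay_onRay hT r2 r).symm

/-- The crossbar theorem for a point of a chord of the angle `geh`. -/
theorem exists_crossbar (h : IsPlane P) {e g g' i i' y : P} (hT : T g' e i') (hB : B g' y i')
    (hg : OnRay e g' g) (hi : OnRay e i' i) : ∃ z, B g z i ∧ OnRay e y z := by
  have hTy := h.orient_ne_zero.2 (h.T_of_B hT hB)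
  have q1 := h.orient_of_B hB e
  have q2 := OnRay.orient h hg y
  have q3 := OnRay.orient h hi y
  have p1 := h.orient_perm g' y e
  have p2 := h.orient_perm g y e
  have p3 := h.orient_perm e i' y
  have p4 := h.orient_perm e i y
  have p5 := h.orient_perm e g y
  have p6 := h.orient_perm g' e y
  have hTg : T e y g := h.orient_ne_zero.1 (by omega)
  obtain ⟨z, hz, hBz⟩ := h.exists_cross (b := e) (d := y) (a := g) (c := i) (by omega) hTg
  refine ⟨z, hBz, ?_⟩
  have q4 := h.orient_of_B hBz e
  have q5 := OnRay.orient h hi g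
  have q6 := OnRay.orient h hg i'
  have q7 := OnRay.orient h hg y
  have p7 := h.orient_perm e z g
  have p8 := h.orient_perm g i e
  have p9 := h.orient_perm e g i'
  have p10 := h.orient_perm e g' i'
  have p11 := h.orient_perm g' i' e
  have p12 := h.orient_perm e i g
  have p13 := h.orient_perm e i' g
  have p14 := h.orient_perm e y g
  exact h.onRay_of_NL_of_orient (p := g) hz hTg (by omega)

/-- With sides of equal length on both angles the triangles are congruent, so the witness can be
copied to the third side; the crossbar theorem then moves it to the segment between the given points
of the arms. -/
theorem AngLT_congr_right (h : IsPlane P) {a b c d e f i j k : P} (hL : AngLT a b c d e f)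
    (hA : AC d e f i j k) : AngLT a b c i j k := by
  obtain ⟨x, h1, h2, hT⟩ := hL
  have hT' := (h.ang_triangle _ _ _ _ _ _ hA).2
  obtain ⟨r1, l1⟩ := h.layoff hT'.2.1.symm hT.2.1
  obtain ⟨r2, l2⟩ := h.layoff hT'.2.2.1 hT.2.2.1
  set i₁ := ext (ext i j i j) j d e
  set k₁ := ext (ext k j k j) j e f
  have hA1 : AC d e f i₁ j k₁ :=
    h.AC_symm (h.AC_ray_left (h.AC_ray_right (h.AC_symm hA) r2) r1)
  have hT1 := (h.ang_triangle _ _ _ _ _ _ hA1).2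
  obtain ⟨s1, s2, -⟩ := h.SAS hA1 (by rw [h.dist_comm i₁, l1]) l2.symm
  obtain ⟨r3, l3⟩ := h.layoff hT1.2.2.2 (h.B_ne₁₂ h1)
  set y := ext (ext k₁ i₁ k₁ i₁) i₁ d x
  have hBy : B i₁ y k₁ := h.B_of_onRay_of_lt (OnRay.symm h r3) (by
    rw [l3, ← s1]; exact (h.dist_lt_of_B h1).1)
  have ray1 : OnRay d f x := ⟨h.B_ne₁₃ h1, Or.inr (Or.inl h1)⟩
  have s3 : AC e d x j i₁ y :=
    h.AC_symm (h.AC_ray_right (h.AC_symm (h.AC_ray_right s2 ray1)) r3)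
  obtain ⟨-, s4, -⟩ := h.SAS s3 (by rw [h.dist_comm, ← l1]) l3.symm
  obtain ⟨z, hz, rz⟩ := h.exists_crossbar hT1 hBy (OnRay.symm h r1) (OnRay.symm h r2)
  exact ⟨z, hz, h.AC_trans h2 (h.AC_symm (h.AC_ray_left (h.AC_ray_right (h.AC_symm s4) rz)
    (OnRay.symm h r1))), hT'⟩

theorem AngLT_trans (h : IsPlane P) {a b c d e f i j k : P} (h1 : AngLT a b c d e f)
    (h2 : AngLT d e f i j k) : AngLT a b c i j k := by
  obtain ⟨y, hy, hAy, hT⟩ := h2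
  obtain ⟨x, hx, hAx, -⟩ := h.AngLT_congr_right h1 hAy
  exact ⟨x, (h.B_inner_trans hx hy).2, hAx, hT⟩

theorem AngLT_flip_left (h : IsPlane P) {a b c d e f : P} (hL : AngLT a b c d e f) :
    AngLT c b a d e f := by
  obtain ⟨x, h1, h2, h3⟩ := hL
  exact ⟨x, h1, h.AC_flip_left h2, h3⟩

theorem AngLT_flip_right (h : IsPlane P) {a b c d e f : P} (hL : AngLT a b c d e f) :
    AngLT a b c f e d := by
  obtain ⟨x, h1, h2, h3⟩ := hL
  exact h.AngLT_congr_right ⟨x, h1, h2, h3⟩ (h.ang_refl _ _ _ h3).2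

/-- The exterior angle at `c` exceeds the opposite angle at `a`. -/
theorem exterior_angle (h : IsPlane P) {a b c d : P} (hT : T a b c) (hB : B b c d) :
    AngLT b a c a c d := by
  obtain ⟨m1, m2⟩ := h.mid_spec a c hT.2.2.2
  set m := mid a c
  have m2 := h.dist_eq_iff.2 m2
  have hTm : T a b m := h.T_of_B hT m1
  -- Euclid I.16: the point reflection in `m` carries the angle at `a` to the angle `acx`, whose arm
  -- `cx` runs inside the exterior angle.
  have hx := h.exists_opposite hTm.2.2.1
  set x := ext b m b m
  have lx := h.dist_ext hTm.2.2.1 b m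
  have hv : AC a m b c m x := h.AC_vertical ((h.T_perm hTm).1) m1 hx
  obtain ⟨-, s, -⟩ := h.SAS hv (by rw [m2]) (by rw [lx, h.dist_comm])
  have hTne := h.orient_ne_zero.2 hT
  have q1 := h.orient_of_B hx a
  have q2 := h.orient_of_B hB a
  have q3 := h.orient_of_B m1 b
  have q4 := h.orient_of_B hx c
  have q5 := h.orient_of_B m1 x
  have q6 := h.orient_of_B hB x
  have p1 := h.orient_perm a m b
  have p2 := h.orient_perm a c b
  have p3 := h.orient_perm a m x
  have p4 := h.orient_perm a c x
  have p5 := h.orient_perm b c x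
  have p6 := h.orient_perm c m b
  have p7 := h.orient_perm c m x
  have p8 := h.orient_perm c d x
  have p9 := h.orient_perm b m a
  have p10 := h.orient_perm b m c
  have p11 := h.orient_perm m x a
  have p12 := h.orient_perm m x c
  have p13 := h.orient_perm a b c
  have p14 := h.orient_perm b c a
  have p15 := h.orient_perm c d a
  have hTx : T c x a := h.orient_ne_zero.1 (by grind)
  obtain ⟨y, hy, hBy⟩ := h.exists_cross (b := c) (d := x) (a := a) (c := d) (by grind) hTx
  have hTd : T a c d := h.orient_ne_zero.1 (by grind)
  have p16 := h.orient_of_B hBy c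
  have p17 := h.orient_perm a y c
  have p18 := h.orient_perm a d c
  have p19 := h.orient_perm c y a
  have p20 := h.orient_perm c x a
  have ry : OnRay c x y := h.onRay_of_NL_of_orient hy hTx (by grind)
  refine ⟨y, hBy, ?_, hTd⟩
  have ray1 : OnRay a m c := ⟨h.B_ne₁₂ m1, Or.inl m1⟩
  have ray2 : OnRay c m a := ⟨h.B_ne₂₃ m1 |>.symm, Or.inl (h.B_symm m1)⟩
  have s2 : AC b a c m c x := h.AC_flip_left (h.AC_ray_left s ray1)
  exact h.AC_symm (h.AC_ray_left (h.AC_ray_right (h.AC_symm s2) ry) ray2)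

/-- The exterior angle at `c` exceeds the opposite angle at `b`. -/
theorem exterior_angle' (h : IsPlane P) {a b c d : P} (hT : T a b c) (hB : B b c d) :
    AngLT a b c a c d := by
  -- Extending `ac` instead of `bc` gives an exterior angle vertical to `acd`.
  have hd := h.exists_opposite hT.2.2.2
  set d' := ext a c a c
  have h1 := h.exterior_angle (h.T_perm hT).2.1 hd
  obtain ⟨-, -, -, h2⟩ := id h1
  exact h.AngLT_flip_right (h.AngLT_congr_right h1 (h.AC_vertical h2 hB (h.B_symm hd)))

/-! ### The triangle inequality -/

theorem dist_lt_of_T (h : IsPlane P) {a b c : P} (hT : T a b c) :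
    h.dist b c < h.dist a b + h.dist a c := by
  obtain ⟨d, r1, l1⟩ : ∃ d, B b a d ∧ h.dist a d = h.dist a c :=
    ⟨_, h.ext_between b a a c ⟨hT.2.1.symm, hT.2.2.2⟩, h.dist_ext hT.2.1.symm a c⟩
  have hTne := h.orient_ne_zero.2 hT
  have o1 := h.orient_of_B r1 c
  have o2 := h.orient_perm a b c
  have o3 := h.orient_perm b a c
  have o4 := h.orient_perm a d c
  have o5 := h.orient_perm b d c
  have hTd : T a d c := h.orient_ne_zero.1 (by grind)
  have hTb : T b d c := h.orient_ne_zero.1 (by grind)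
  have hbd : h.dist b d = h.dist a b + h.dist a c := by
    rw [← h.dist_add r1, l1, h.dist_comm b a]
  have iso := h.isosceles hTd l1
  -- the angle at `d` is smaller than the angle at `c` in the triangle `bdc`
  have ray : OnRay d a b := ⟨(h.B_ne₂₃ r1).symm, Or.inl (h.B_symm r1)⟩
  have hA : AC b d c a c d := h.AC_ray_left iso ray
  have hlt : AngLT b d c b c d :=
    h.AngLT_congr_left hA (h.AngLT_flip_left (h.AngLT_flip_right
      (h.AngLT_of_B (h.T_perm hTb).2.2.1 (h.B_symm r1))))
  rw [← hbd]
  by_contra hcon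
  rcases (not_lt.1 hcon).eq_or_lt with heq | hl
  · exact h.not_AngLT_of_AC (h.isosceles hTb heq) hlt
  · have hbc : b ≠ c := hT.2.2.1
    have hbd' : b ≠ d := h.B_ne₁₃ r1
    -- If bd < bc, cut off `be = bd` on `bc`. Then bde < bdc < bcd < bed, against the equality of
    -- base angles in the triangle `bde`.
    obtain ⟨e, re, le⟩ : ∃ e, OnRay b c e ∧ h.dist b e = h.dist b d := ⟨_, h.layoff hbc hbd'⟩
    have hBe : B b e c := h.B_of_onRay_of_lt (OnRay.symm h re) (by rwa [le])
    have hTe : T b d e := (h.T_perm (h.T_of_onRay (h.T_perm hTb).2.1 re)).2.1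
    have i2 : AC b d e b e d := h.isosceles hTe le.symm
    have hTde : T d c e := by
      have o6 := h.orient_of_B hBe d
      have o7 := h.orient_perm e c d
      have o8 := h.orient_perm b c d
      exact h.orient_ne_zero.1 (by grind)
    have e1 : AngLT d c e d e b := h.exterior_angle' hTde (h.B_symm hBe)
    have ray2 : OnRay c e b := ⟨(h.B_ne₂₃ hBe).symm, Or.inl (h.B_symm hBe)⟩
    have e2 : AngLT b c d d e b :=
      h.AngLT_congr_left (h.AC_ray_left (h.AC_flip_left (h.ang_refl _ _ _ hTde).1) ray2) e1
    have e3 : AngLT b d e b d c := h.AngLT_of_B hTb hBe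
    have e4 := h.AngLT_trans (h.AngLT_trans e3 hlt) e2
    exact h.not_AngLT_of_AC (h.AC_symm (h.AC_flip_left (h.AC_symm i2))) e4

theorem dist_triangle (h : IsPlane P) (a b c : P) : h.dist a c ≤ h.dist a b + h.dist b c := by
  by_cases hT : T b a c
  · have := h.dist_lt_of_T hT
    rw [h.dist_comm b a] at this
    exact this.le
  have n0 := h.len_nonneg (h.dist a b)
  have n1 := h.len_nonneg (h.dist b c)
  rw [h.T_iff, not_not] at hT
  rcases hT with (H | H | H) | H | H | H
  · have := h.dist_lt_of_B H
    grind
  · have := h.dist_lt_of_B H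
    have := h.dist_comm a b
    have := h.dist_comm a c
    grind
  · rw [h.dist_add H]
  · rw [H, h.dist_self, zero_add]
  · rw [H, h.dist_self]; grind
  · rw [H, h.dist_self, add_zero]

/-- Equality in the triangle inequality excludes proper triangles, because there it is strict. -/
theorem B_of_dist_add_eq (h : IsPlane P) {a b c : P} (hd : h.dist a b + h.dist b c = h.dist a c) :
    B a b c ∨ a = b ∨ b = c := by
  have hT : ¬ T b a c := fun hT => by
    have := h.dist_lt_of_T hT
    rw [h.dist_comm b a, hd] at this
    exact lt_irrefl _ this
  have n0 := h.len_nonneg (h.dist a b)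
  have n1 := h.len_nonneg (h.dist b c)
  rw [h.T_iff, not_not] at hT
  rcases hT with (H | H | H) | H | H | H
  · have := h.dist_lt_of_B H
    grind
  · have := h.dist_lt_of_B H
    have := h.dist_comm a c
    have := h.dist_comm a b
    grind
  · exact Or.inl H
  · exact Or.inr (Or.inl H.symm)
  · subst H
    rw [h.dist_self] at hd
    exact Or.inr (Or.inl (h.dist_eq_zero.1 (by grind)))
  · exact Or.inr (Or.inr H)

end IsPlane

/-- The point `c'` is the mirror image in the line `ab` of the point `c` outside this line. -/
def IsReflection (h : IsPlane P) (a b c c' : P) : Prop :=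
  T a b c ∧ orient a b c' = - orient a b c ∧ ∀ x, NL a b x → h.dist x c = h.dist x c'

namespace IsPlane

/-! ### Reflections in lines -/

/-- The ends of a segment crossing a line have opposite orientations with respect to it. -/
theorem orient_of_B_line (h : IsPlane P) {a b w x y : P} (hw : NL a b w) (hB : B x w y) :
    orient a b y = - orient a b x := by
  have q1 := h.orient_of_B hB a
  have q2 := h.orient_of_B hB b
  have p1 := h.orient_perm a w x
  have p2 := h.orient_perm a w y
  have p3 := h.orient_perm a b x
  have p4 := h.orient_perm a b y
  rcases hw with (K | K | K) | K | K | K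
  iterate 3
    have := h.orient_of_B K x
    have := h.orient_of_B K y
    grind
  · rw [h.orient_eq_zero.2 (Or.inr (Or.inl K)), h.orient_eq_zero.2 (Or.inr (Or.inl K)), neg_zero]
  · rw [K]; grind
  · have p5 := h.orient_perm b w x
    have p6 := h.orient_perm b w y
    rw [K]; grind

theorem isReflection_ats (h : IsPlane P) {a b c f : P} (hT : T a b c) (hf : B c a f) :
    IsReflection h a b c (ats b a c b a f) := by
  have hT' := (h.T_perm hT).2.1
  have q1 := h.orient_of_B hf b
  have q2 := h.orient_perm a f b
  have q3 := h.orient_perm c a b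
  have q4 := h.orient_ne_zero.2 hT
  have hTf : T b a f := h.orient_ne_zero.1 (by grind)
  obtain ⟨s1, s2, s3⟩ := h.ats_spec b a c b a f ⟨hT', hTf⟩
  generalize ats b a c b a f = x at *
  have s2 := (h.SO_iff.1 s2).1
  have s3 := h.dist_eq_iff.2 s3
  have q5 := h.orient_perm a b x
  have q6 := h.orient_perm a b f
  refine ⟨hT, by grind, fun y hy => ?_⟩
  by_cases hya : y = a
  · rwa [hya]
  have hB : OnRay a b y ∨ B b a y := by
    have h1 := hT.2.1
    -- On the ray `ab` side-angle-side applies directly, on the opposite ray after passing to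
    -- supplements.
    unfold OnRay
    rcases hy with (H | H | H) | H | H | H <;> grind
  rcases hB with H | H
  · exact (h.SAS (h.AC_symm (h.AC_ray_left (h.AC_symm (h.AC_ray_left s1 H)) H)) rfl s3).1
  · exact (h.SAS (h.AC_flip (h.AC_supplement (h.AC_flip s1) H H)) rfl s3).1

theorem IsReflection.symm (h : IsPlane P) {a b c c' : P} (hR : IsReflection h a b c c') :
    IsReflection h a b c' c := by
  obtain ⟨h1, h2, h3⟩ := hR
  have := h.orient_ne_zero.2 h1
  exact ⟨h.orient_ne_zero.1 (by grind), by grind, fun x hx => (h3 x hx).symm⟩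

theorem IsReflection.mid (h : IsPlane P) {a b c c' : P} (hR : IsReflection h a b c c') :
    NL a b (mid c c') ∧ B c (mid c c') c' ∧ h.dist c (Geo.mid c c') = h.dist (Geo.mid c c') c' := by
  obtain ⟨h1, h2, h3⟩ := hR
  obtain ⟨k, hk, hB⟩ := h.exists_cross (b := a) (d := b) (a := c) (c := c') (by grind) h1
  have hd : h.dist c k = h.dist k c' := by rw [h.dist_comm, h3 k hk]
  rw [← h.mid_unique hB hd]
  exact ⟨hk, hB, hd⟩

theorem IsReflection.not_equidistant (h : IsPlane P) {a b c c' y : P}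
    (hR : IsReflection h a b c c') (hd : h.dist y c = h.dist y c') :
    orient a b y ≠ orient a b c := by
  obtain ⟨h1, h2, h3⟩ := hR
  intro ho
  have hne := h.orient_ne_zero.2 h1
  have hy : T a b y := h.orient_ne_zero.1 (by grind)
  -- If `y` were on the side of `c`, then with `w` on the axis yc = yc' = yw + wc' = yw + wc, so `w`
  -- would separate `y` from `c` or coincide with one of them.
  obtain ⟨w, hw, hB⟩ := h.exists_cross (b := a) (d := b) (a := y) (c := c') (by grind) hy
  have e1 := h.dist_add hB
  rw [← h3 w hw, ← hd] at e1
  rcases h.B_of_dist_add_eq e1 with H | H | H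
  · have := h.orient_of_B_line hw H
    grind
  · subst H
    exact hne (by rw [← ho]; exact h.orient_eq_zero.2 hw)
  · subst H
    exact hne (h.orient_eq_zero.2 hw)

/-- Points equidistant from `c` and its mirror image lie on the axis. -/
theorem IsReflection.NL_of_equidistant (h : IsPlane P) {a b c c' y : P}
    (hR : IsReflection h a b c c') (hd : h.dist y c = h.dist y c') : NL a b y := by
  have h1 := IsReflection.not_equidistant h hR hd
  have h2 := IsReflection.not_equidistant h (IsReflection.symm h hR) hd.symm
  have h3 := hR.2.1
  have h4 := h.orient_ne_zero.2 hR.1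
  rw [← h.orient_eq_zero]
  unfold orient at *
  grind

theorem T_of_line (h : IsPlane P) {a b c x y : P} (hT : T a b c) (hx : NL a b x) (hy : NL a b y)
    (hxy : x ≠ y) : T x y c := by
  refine h.T_iff.2 fun H => h.T_iff.1 hT ?_
  have na : NL a b a := Or.inr (Or.inr (Or.inr rfl))
  have nb : NL a b b := Or.inr (Or.inr (Or.inl rfl))
  exact h.NL_line hxy (h.NL_line hT.2.1 hx hy na) (h.NL_line hT.2.1 hx hy nb) H

/-- Points of the axis symmetric about the foot of `c` are equidistant from `c`. -/
theorem IsReflection.dist_eq (h : IsPlane P) {a b c c' y z : P} (hR : IsReflection h a b c c')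
    (hy : NL a b y) (hz : NL a b z) (hB : B y (Geo.mid c c') z)
    (hd : h.dist y (Geo.mid c c') = h.dist (Geo.mid c c') z) : h.dist c y = h.dist c z := by
  obtain ⟨k1, k2, k3⟩ := IsReflection.mid h hR
  generalize Geo.mid c c' = k at *
  have hT := h.T_of_line hR.1 k1 hy (h.B_ne₁₂ hB).symm
  -- The triangles `cky` and `c'kz` are congruent, and `z` is equidistant from `c` and `c'`.
  have hA := h.AC_vertical (h.T_perm hT).2.2.2.1 k2 hB
  have := (h.SAS hA (by rw [k3, h.dist_comm]) (by rw [h.dist_comm, hd])).1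
  rw [this, h.dist_comm c', ← hR.2.2 z hz, h.dist_comm]

/-- The distance from `c` increases away from its foot on the axis. -/
theorem IsReflection.dist_lt (h : IsPlane P) {a b c c' x y : P} (hR : IsReflection h a b c c')
    (hx : NL a b x) (hy : NL a b y) (hB : B (Geo.mid c c') x y) : h.dist c x < h.dist c y := by
  obtain ⟨k1, k2, k3⟩ := IsReflection.mid h hR
  generalize Geo.mid c c' = k at *
  have hky := h.B_ne₁₃ hB
  have hkx := h.B_ne₁₂ hB
  have hxy := h.B_ne₂₃ hB
  have hT := h.T_of_line hR.1 k1 hy hky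
  have hTx := h.T_of_line hR.1 k1 hx hkx
  have hTy := h.T_of_line hR.1 hx hy hxy
  have z1 := h.orient_ne_zero.2 hTy
  have q1 := h.orient_of_B hB c
  have q2 := h.orient_of_B k2 x
  have q3 := h.orient_of_B k2 y
  have p1 := h.orient_perm c x y
  have p2 := h.orient_perm c x k
  have p3 := h.orient_perm c x c'
  have p4 := h.orient_perm c c' y
  have p5 := h.orient_perm k c' y
  have p6 := h.orient_perm k y c
  have p7 := h.orient_perm c k x
  have p8 := h.orient_perm k y c'
  have p9 := h.orient_perm k x c
  have p10 := h.orient_perm c k y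
  -- The path `c`, `x`, `c'` lies inside the path `c`, `y`, `c'`. Extending `cx` to `w` on `yc'`
  -- compares them: cx + xc' ≤ cw + wc' < cy + yc', and both sides are doubled distances.
  obtain ⟨w, hw, hBw⟩ := h.exists_cross (b := c) (d := x) (a := y) (c := c') (by grind)
    (h.T_perm hTy).2.2.2.1
  have q4 := h.orient_of_B hBw k
  have p11 := h.orient_perm y w k
  have p12 := h.orient_perm y c' k
  have p13 := h.orient_perm k y w
  have hwc : orient k y w = - orient k y c := by grind
  have hTw : T k y w := h.orient_ne_zero.1 (by grind)
  -- The crossing `v` of `wc` with the axis must be `x`, which places `x` between `c` and `w`.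
  obtain ⟨v, hv, hBv⟩ := h.exists_cross (b := k) (d := y) (a := w) (c := c) (by grind) hTw
  have hcx : c ≠ x := hTy.2.2.2.symm
  have hkyx : NL k y x := (h.NL_perm (h.NL_of_B hB)).1
  have hcv : NL c x v := h.NL_trans (h.B_ne₁₃ hBv).symm (h.NL_perm hw).1
    (h.NL_perm (h.NL_of_B hBv)).2.2.2.1
  have hvx : v = x := by
    by_contra hne
    exact h.T_iff.1 (h.T_of_line hT hv hkyx hne) (h.NL_perm hcv).2.2.2.2
  subst hvx
  have e1 := h.dist_add (h.B_symm hBv)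
  have e2 := h.dist_triangle c y w
  have e3 := h.dist_triangle v w c'
  have e4 := h.dist_add hBw
  have e5 := hR.2.2 v hx
  have e6 := hR.2.2 y hy
  have e7 := h.dist_comm c v
  have e8 := h.dist_comm c y
  by_contra hcon
  have e9 : h.dist c y + h.dist y w = h.dist c w := by grind
  rcases h.B_of_dist_add_eq e9 with H | H | H
  · have : NL c w y := (h.NL_perm (h.NL_of_B H)).1
    have hcw : c ≠ w := h.B_ne₁₃ H
    have : NL c v y := h.NL_trans hcw (h.NL_perm (h.NL_of_B (h.B_symm hBv))).1 this
    exact h.T_iff.1 hTy (h.NL_perm this).2.2.1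
  · exact hTy.2.2.1 H.symm
  · exact h.B_ne₁₂ hBw H

end IsPlane

/-! ### Uniform constructions for the intersection of a segment and a circle -/

/-- The point at distance `rs` from `p` on the ray from `p` through `q`. -/
def layOff (p q r s : P) : P := ext (ext q p q p) p r s

/-- The mirror image of `c` in the line `ab`, for `c` outside this line. -/
def mirror (a b c : P) : P := ats b a c b a (ext c a c a)

/-- The intersection of the segment `ab` with the circle around `c` through `d`,
for `c` outside the line `ab`. -/
def meetOffLine (a b c d : P) : P :=
  layOff (mid c (mirror a b c)) b (mid c (mirror a b c))
    (cci (mirror a b c) (layOff (mirror a b c) c c d) (ext c (mirror a b c) c d) c d)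

/-- The point among `u` and `e` that is nearer to `b`, if these points lie on a ray from `b`. -/
def nearer (b u e : P) : P := ext (ext b (mid e u) b (mid e u)) (mid e u) (mid e u) e

/-- The intersection of the segment `ab` with the circle around `c` through `d`. -/
def meet (a b c d : P) : P :=
  nearer b
    (ext b (layOff b a b (layOff c b c d)) (layOff b a b (layOff c b c d)) (meetOffLine a b c d))
    (ext b (layOff b a b (layOff c b c d)) c (layOff b a b c))

/-- The second intersection of the circle around `c₁` through `a` and `b` with the circle around
`c₂` through `d`. -/
def secondMeet (c₁ a b c₂ d : P) : P :=
  ats c₂ c₁ (cci c₁ a b c₂ d) c₂ c₁ (ext (cci c₁ a b c₂ d) c₁ (cci c₁ a b c₂ d) c₁)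

/-! ### Correctness of the constructions -/

namespace IsPlane

theorem onRay_layOff (h : IsPlane P) {p q r s : P} (hpq : p ≠ q) (hrs : r ≠ s) :
    OnRay p q (layOff p q r s) ∧ h.dist p (layOff p q r s) = h.dist r s :=
  h.layoff hpq hrs

theorem eq_layOff (h : IsPlane P) {p q r s x : P} (hr : OnRay p q x)
    (hd : h.dist p x = h.dist r s) : x = layOff p q r s :=
  h.eq_ext (Or.inl ((h.onRay_iff_B (h.B_symm (h.exists_opposite hr.1.symm))).1 hr)) hd

theorem isReflection_mirror (h : IsPlane P) {a b c : P} (hT : T a b c) :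
    IsReflection h a b c (mirror a b c) :=
  h.isReflection_ats hT (h.exists_opposite hT.2.2.2.symm)

/-- Doubling `bm` gives a point beyond `m`, from which extension past `m` runs towards `b`; this
works for either order of `e` and `u`. -/
theorem nearer_of_B (h : IsPlane P) {b x y u e m : P} (hB : B b x y) (hm : m = mid e u)
    (hm' : B x m y) (hd : h.dist m x = h.dist m e) : x = nearer b u e := by
  have h1 := h.B_symm (h.B_inner_trans (h.B_symm hm') (h.B_symm hB)).1
  have h2 := h.exists_opposite (h.B_ne₁₃ h1)
  have h3 := h.B_symm (h.B_inner_trans h1 h2).1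
  unfold nearer
  rw [← hm]
  exact h.eq_ext (Or.inl h3) hd

theorem nearer_self (h : IsPlane P) {b u : P} (hb : b ≠ u) : nearer b u u = u := by
  unfold nearer
  rw [h.mid_self]
  exact h.ext_null u (h.B_ne₂₃ (h.exists_opposite hb)).symm

theorem nearer_eq_right (h : IsPlane P) {b u e : P} (hb : b ≠ e) (hB : u = e ∨ B b e u) :
    nearer b u e = e := by
  rcases hB with rfl | hB
  · exact h.nearer_self hb
  · exact (h.nearer_of_B hB rfl (h.mid_spec _ _ (h.B_ne₂₃ hB)).1 rfl).symm

theorem nearer_eq_left (h : IsPlane P) {b u e : P} (hb : b ≠ u) (hB : u = e ∨ B b u e) :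
    nearer b u e = u := by
  rcases hB with rfl | hB
  · exact h.nearer_self hb
  · obtain ⟨m1, m2⟩ := h.mid_spec _ _ (h.B_ne₂₃ hB).symm
    refine (h.nearer_of_B hB rfl (h.B_symm m1) ?_).symm
    rw [h.dist_comm, ← h.dist_eq_iff.2 m2, h.dist_comm]

/-- The circle around `c` and its mirror image in a line meet if the radius exceeds the distance
of `c` from some point of the line. -/
theorem cci_mirror (h : IsPlane P) {a b c c' d : P} (hR : IsReflection h a b c c')
    (had : h.dist c a < h.dist c d) :
    h.dist c' (cci c' (layOff c' c c d) (ext c c' c d) c d) = h.dist c d ∧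
    h.dist c (cci c' (layOff c' c c d) (ext c c' c d) c d) = h.dist c d := by
  obtain ⟨-, k2, k3⟩ := IsReflection.mid h hR
  have hcc := h.B_ne₁₃ k2
  have n0 := h.len_nonneg (h.dist c a)
  have hcd : c ≠ d := h.dist_pos.1 (lt_of_le_of_lt n0 had)
  have e1 := h.dist_add k2
  have e2 := h.dist_triangle c a c'
  have e3 := hR.2.2 a (Or.inr (Or.inr (Or.inr rfl)))
  have e4 := h.dist_comm c a
  obtain ⟨p1, p2⟩ := h.onRay_layOff hcc.symm hcd
  have q1 := h.ext_between c c' c d ⟨hcc, hcd⟩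
  have q2 := h.dist_ext hcc c d
  have q3 := h.dist_add q1
  have e5 := h.dist_pos.2 hcc
  generalize layOff c' c c d = p at *
  generalize ext c c' c d = q at *
  have e6 := h.dist_comm c c'
  -- The near point `p` is at distance |cc' - cd| from `c`, and 0 < cc' ≤ 2ca < 2cd.
  have hp : h.dist c p < h.dist c d := by
    rcases p1.2 with H | H | H
    · have := h.dist_add H
      grind
    · have := h.dist_add H
      have := h.dist_comm c p
      grind
    · rw [← H, h.dist_self]
      exact lt_of_le_of_lt n0 had
  have := h.cci_spec c' p q c d ⟨h.dist_eq_iff.1 (by rw [p2, q2]), h.segLT_iff.2 hp,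
    h.segLT_iff.2 (by rw [← q3, q2]; grind)⟩
  rw [← h.dist_eq_iff, ← h.dist_eq_iff, p2] at this
  exact this

/-- The circles around `c` and `c'` are mirror images, so a common point is equidistant from the
centres and lies on the axis. The final bound, a leg being at most the hypotenuse, is what
`meet_of_T` needs to select this point. -/
theorem meetOffLine_spec (h : IsPlane P) {a b c d : P} (hT : T a b c)
    (had : h.dist c a < h.dist c d) (hdb : h.dist c d < h.dist c b) :
    B a (meetOffLine a b c d) b ∧ h.dist c (meetOffLine a b c d) = h.dist c d ∧
    h.dist b (meetOffLine a b c d) ≤ h.dist b c := by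
  have hR := h.isReflection_mirror hT
  obtain ⟨y1, y2⟩ := h.cci_mirror hR had
  unfold meetOffLine
  generalize mirror a b c = c' at *
  generalize cci c' (layOff c' c c d) (ext c c' c d) c d = y at *
  obtain ⟨k1, k2, k3⟩ := IsReflection.mid h hR
  have hNy : NL a b y := IsReflection.NL_of_equidistant h hR (by
    rw [h.dist_comm y c, y2, h.dist_comm y c', y1])
  have na : NL a b a := Or.inr (Or.inr (Or.inr rfl))
  have nb : NL a b b := Or.inr (Or.inr (Or.inl rfl))
  have e1 := h.dist_add k2
  have e2 := h.dist_triangle c a c'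
  have e3 := hR.2.2 a na
  have e4 := h.dist_comm c a
  have mono := fun x z hx hz hB => IsReflection.dist_lt h (x := x) (y := z) hR hx hz hB
  have symm := fun x z hx hz hB hd => IsReflection.dist_eq h (y := x) (z := z) hR hx hz hB hd
  generalize mid c c' = k at *
  have hka : h.dist c k ≤ h.dist c a := by grind
  have hky : k ≠ y := by
    rintro rfl
    exact absurd y2 (lt_of_le_of_lt hka had).ne
  have hkb : k ≠ b := by
    rintro rfl
    exact absurd hdb (lt_of_le_of_lt hka had).le.not_gt
  obtain ⟨z1, z2⟩ := h.onRay_layOff hkb hky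
  generalize layOff k b k y = z at *
  have hNz : NL a b z := by
    have hz := (OnRay.NL h z1)
    have n1 : NL k b a := h.NL_line hT.2.1 k1 nb na
    have n2 : NL k b b := Or.inr (Or.inr (Or.inl rfl))
    exact h.NL_line hkb n1 n2 hz
  have hkz := OnRay.ne h z1
  -- Since kz = ky, the point `z` is either `y` or symmetric to it about `k`.
  have hcz : h.dist c z = h.dist c d := by
    rw [← y2]
    rcases h.NL_line hT.2.1 k1 hNy hNz with (H | H | H) | H | H | H
    · exact absurd z2 (h.dist_lt_of_B H).1.ne'
    · exact absurd z2 (h.dist_lt_of_B H).1.ne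
    · exact (symm y z hNy hNz H (by rw [h.dist_comm, z2])).symm
    · exact absurd H hky
    · rw [H]
    · exact absurd H hkz
  have hkzb : B k z b := by
    rcases z1.2 with H | H | H
    · have := mono _ _ nb hNz H
      grind
    · exact H
    · rw [← H] at hcz
      exact absurd hcz hdb.ne'
  have hzb : B a z b := by
    have hza : a ≠ z := by
      rintro rfl
      exact absurd hcz had.ne
    have hN : NL k z a := h.NL_line hT.2.1 k1 hNz na
    rcases hN with (H | H | H) | H | H | H
    · have := mono _ _ hNz na H
      grind
    · exact (h.B_inner_trans H hkzb).1
    · exact (h.B_outer_trans (h.B_symm H) hkzb).2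
    · exact absurd H hkz
    · exact absurd H.symm hza
    · rwa [← H]
  refine ⟨hzb, hcz, ?_⟩
  -- With `w` symmetric to `b` about `k`, 2bk = bw ≤ bc + cw = 2bc, and bz < bk.
  have w1 := h.exists_opposite hkb.symm
  have w2 := h.dist_ext hkb.symm b k
  generalize ext b k b k = w at *
  have hNw : NL a b w := by
    have n1 : NL b k a := h.NL_line hT.2.1 nb k1 na
    have n2 : NL b k b := Or.inr (Or.inr (Or.inr rfl))
    exact h.NL_line hkb.symm n1 n2 (h.NL_of_B w1)
  have w3 := symm b w nb hNw w1 w2.symm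
  have w4 := h.dist_triangle b c w
  have w5 := h.dist_add w1
  have w6 := (h.dist_lt_of_B hkzb).2
  have w7 := h.dist_comm b c
  have w8 := h.dist_comm b z
  have w9 := h.dist_comm b k
  grind

/-- The two candidates sit at distances bz and bw + cg from `b`, and the first is the smaller. -/
theorem meet_of_T (h : IsPlane P) {a b c d : P} (hT : T a b c)
    (had : h.dist c a < h.dist c d) (hdb : h.dist c d < h.dist c b) :
    meet a b c d = meetOffLine a b c d := by
  obtain ⟨z1, z2, z3⟩ := h.meetOffLine_spec hT had hdb
  unfold meet
  generalize meetOffLine a b c d = z at *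
  have hcd : c ≠ d := h.dist_pos.1 (lt_of_le_of_lt (h.len_nonneg _) had)
  have hbc := hT.2.2.1
  have hba := hT.2.1.symm
  obtain ⟨u1, u2⟩ := h.onRay_layOff hbc.symm hcd
  generalize layOff c b c d = w₀ at *
  have hB0 : B c w₀ b := h.B_of_onRay_of_lt (OnRay.symm h u1) (by rw [u2]; exact hdb)
  obtain ⟨w1, w2⟩ := h.onRay_layOff hba (h.B_ne₂₃ hB0).symm
  generalize layOff b a b w₀ = w at *
  obtain ⟨g1, g2⟩ := h.onRay_layOff hba hbc
  generalize layOff b a b c = g at *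
  have rz : OnRay b a z := ⟨hba, Or.inr (Or.inl (h.B_symm z1))⟩
  have hbz := (h.B_ne₂₃ z1).symm
  have hbw := OnRay.ne h w1
  have e1 := h.dist_add hB0
  have e2 := h.dist_triangle b z c
  have e3 := h.dist_comm w₀ b
  have e4 := h.dist_comm c b
  have e5 := h.dist_comm c z
  have hwz : h.dist b w ≤ h.dist b z := by grind
  have rwz := h.onRay_trans w1 rz
  have rgz := h.onRay_trans rz g1
  -- Here bw = bc - cd ≤ bz because cz = cd, so `w` does not lie past `z`.
  have hu : ext b w w z = z := by
    refine (h.eq_ext ?_ rfl).symm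
    rcases rwz.2 with H | H | H
    · exact Or.inl H
    · exact absurd hwz (h.dist_lt_of_B H).1.not_ge
    · exact Or.inr H
  rw [hu]
  refine h.nearer_eq_left hbz ?_
  have l1 := h.dist_ext hbw c g
  have l2 := h.ext_eq_or_B c g hbw
  generalize ext b w c g = e at *
  have l3 : h.dist b e = h.dist b w + h.dist c g := by
    rcases l2 with H | H
    · rw [← l1, H, h.dist_self, add_zero]
    · rw [← l1, h.dist_add H]
  have l4 := h.dist_triangle c g z
  -- The order `b`, `g`, `z` is excluded by bz ≤ bc = bg.
  have l5 : h.dist b z + h.dist g z = h.dist b g := by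
    rcases rgz.2 with H | H | H
    · rw [h.dist_comm g, h.dist_add H]
    · have := h.dist_lt_of_B H
      grind
    · rw [H, h.dist_self, add_zero]
  -- Indeed cg ≥ cz - gz = cd - (bc - bz), hence bw + cg ≥ bz.
  have hze : h.dist b z ≤ h.dist b e := by grind
  have rwe : OnRay b w e := by
    rcases l2 with H | H
    · exact ⟨hbw, Or.inr (Or.inr H.symm)⟩
    · exact ⟨hbw, Or.inl H⟩
  rcases (h.onRay_trans rwz rwe).2 with H | H | H
  · exact Or.inr H
  · exact absurd hze (h.dist_lt_of_B H).1.not_ge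
  · exact Or.inl H

/-- The inequalities put `c` on the ray `ba`, so laying off on that ray reproduces both `c` and `w`.
The second candidate is then `w` itself, and the first lies at or beyond it whatever the value of
the off-line construction. -/
theorem meet_of_NL (h : IsPlane P) {a b c d : P} (hab : a ≠ b) (hN : NL a b c)
    (had : h.dist c a < h.dist c d) (hdb : h.dist c d < h.dist c b) :
    B a (meet a b c d) b ∧ h.dist c (meet a b c d) = h.dist c d := by
  unfold meet
  generalize meetOffLine a b c d = z at *
  have hcd : c ≠ d := h.dist_pos.1 (lt_of_le_of_lt (h.len_nonneg _) had)
  have hbc : c ≠ b := h.dist_pos.1 (lt_of_le_of_lt (h.len_nonneg _) hdb)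
  obtain ⟨u1, u2⟩ := h.onRay_layOff hbc hcd
  generalize layOff c b c d = w at *
  have hB0 : B c w b := h.B_of_onRay_of_lt (OnRay.symm h u1) (by rw [u2]; exact hdb)
  have hac : OnRay b a c ∧ B a w b := by
    unfold OnRay
    rcases hN with (H | H | H) | H | H | H
    · have := (h.dist_lt_of_B H).2
      have := h.dist_comm c b
      have := h.dist_comm c a
      grind
    · exact ⟨⟨hab.symm, Or.inr (Or.inl (h.B_symm H))⟩,
        h.B_symm (h.B_inner_trans (h.B_symm hB0) (h.B_symm H)).2⟩
    · refine ⟨⟨hab.symm, Or.inl H⟩, ?_⟩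
      rcases h.B_or_of_within (h.B_symm H) hB0 with K | K | K
      · rw [K, u2] at had
        exact absurd had (lt_irrefl _)
      · exact (h.B_inner_trans K hB0).1
      · have := (h.dist_lt_of_B K).1
        grind
    · exact absurd H hab
    · exact absurd H.symm hbc
    · rw [H]
      exact ⟨⟨hbc.symm, Or.inr (Or.inr rfl)⟩, hB0⟩
  obtain ⟨rc, hw⟩ := hac
  rw [← h.eq_layOff rc rfl]
  have rw' : OnRay b a w := ⟨hab.symm, Or.inr (Or.inl (h.B_symm hw))⟩
  rw [← h.eq_layOff rw' rfl]
  have hbw := (h.B_ne₂₃ hw).symm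
  -- The extension has length cc and collapses to `w`.
  rw [h.ext_null c hbw, h.nearer_eq_right hbw (h.ext_eq_or_B w z hbw)]
  exact ⟨hw, u2⟩

/-- Segment-circle continuity. -/
theorem meet_spec (h : IsPlane P) {a b c d : P}
    (had : h.dist c a < h.dist c d) (hdb : h.dist c d < h.dist c b) :
    B a (meet a b c d) b ∧ h.dist c (meet a b c d) = h.dist c d := by
  by_cases hT : T a b c
  · rw [h.meet_of_T hT had hdb]
    obtain ⟨h1, h2, -⟩ := h.meetOffLine_spec hT had hdb
    exact ⟨h1, h2⟩
  · refine h.meet_of_NL ?_ (by rwa [h.T_iff, not_not] at hT) had hdb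
    rintro rfl
    exact absurd had hdb.le.not_gt

theorem secondMeet_spec (h : IsPlane P) {c₁ a b c₂ d : P} (hc : h.dist c₁ a = h.dist c₁ b)
    (had : h.dist c₂ a < h.dist c₂ d) (hdb : h.dist c₂ d < h.dist c₂ b) :
    h.dist c₁ (secondMeet c₁ a b c₂ d) = h.dist c₁ a ∧
    h.dist c₂ (secondMeet c₁ a b c₂ d) = h.dist c₂ d ∧
    secondMeet c₁ a b c₂ d ≠ cci c₁ a b c₂ d := by
  have hy := h.cci_spec c₁ a b c₂ d
    ⟨h.dist_eq_iff.1 hc, h.segLT_iff.2 had, h.segLT_iff.2 hdb⟩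
  rw [← h.dist_eq_iff, ← h.dist_eq_iff] at hy
  obtain ⟨y1, y2⟩ := hy
  unfold secondMeet
  generalize cci c₁ a b c₂ d = y at *
  have n0 := h.len_nonneg (h.dist c₂ a)
  have hab : a ≠ b := by
    rintro rfl
    exact absurd had hdb.le.not_gt
  have hcc : c₁ ≠ c₂ := by
    rintro rfl
    exact absurd hc (had.trans hdb).ne
  -- tangent circles are excluded by the triangle inequality
  have hT : T c₁ c₂ y := by
    rw [h.T_iff]
    have t1 := h.dist_triangle c₁ a c₂
    have t2 := h.dist_triangle c₁ c₂ a
    have t3 := h.dist_triangle c₂ c₁ b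
    have s1 := h.dist_comm a c₂
    have s2 := h.dist_comm c₂ c₁
    have s3 := h.dist_comm y c₂
    have s4 := h.dist_comm y c₁
    rintro ((H | H | H) | H | H | H)
    · have := h.dist_add H
      grind
    · have := h.dist_add H
      grind
    · have := h.dist_add H
      grind
    · exact hcc H
    · subst H
      rw [h.dist_self] at y2
      grind
    · subst H
      rw [h.dist_self] at y1
      have h1 := h.dist_eq_zero.1 y1.symm
      have h2 := h.dist_eq_zero.1 (hc.symm.trans y1.symm)
      exact hab (h1.symm.trans h2)
  have hR := h.isReflection_ats hT (h.exists_opposite hT.2.2.2.symm)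
  generalize ats c₂ c₁ y c₂ c₁ (ext y c₁ y c₁) = x at *
  obtain ⟨-, ho, hd⟩ := hR
  refine ⟨?_, ?_, ?_⟩
  · rw [← hd c₁ (Or.inr (Or.inr (Or.inr rfl))), y1]
  · rw [← hd c₂ (Or.inr (Or.inr (Or.inl rfl))), y2]
  · rintro rfl
    have := h.orient_ne_zero.2 hT
    grind

end IsPlane

/-! ### Terms -/

section Terms

open Language

variable {ι : Type}

/-- The term for segment extension. -/
def extTerm (a b c d : geoLang.Term ι) : geoLang.Term ι :=
  Term.func (GeoConstruction.ext : geoLang.Functions 4) ![a, b, c, d]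

/-- The term for angle transport. -/
def atsTerm (a b c d e f : geoLang.Term ι) : geoLang.Term ι :=
  Term.func (GeoConstruction.ats : geoLang.Functions 6) ![a, b, c, d, e, f]

/-- The term for midpoints. -/
def midTerm (a b : geoLang.Term ι) : geoLang.Term ι :=
  Term.func (GeoConstruction.mid : geoLang.Functions 2) ![a, b]

/-- The term for circle-circle intersection. -/
def cciTerm (a b c d e : geoLang.Term ι) : geoLang.Term ι :=
  Term.func (GeoConstruction.cci : geoLang.Functions 5) ![a, b, c, d, e]

variable (v : ι → P)

theorem realize_extTerm (a b c d : geoLang.Term ι) : (extTerm a b c d).realize v =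
    ext (a.realize v) (b.realize v) (c.realize v) (d.realize v) := by
  -- Realization acts entrywise on the argument tuple, so the tuples are compared entry by entry.
  refine congrArg (Structure.funMap (L := geoLang) GeoConstruction.ext) (funext fun i => ?_)
  fin_cases i <;> rfl

theorem realize_atsTerm (a b c d e f : geoLang.Term ι) : (atsTerm a b c d e f).realize v =
    ats (a.realize v) (b.realize v) (c.realize v) (d.realize v) (e.realize v) (f.realize v) := by
  refine congrArg (Structure.funMap (L := geoLang) GeoConstruction.ats) (funext fun i => ?_)
  fin_cases i <;> rfl

theorem realize_midTerm (a b : geoLang.Term ι) :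
    (midTerm a b).realize v = mid (a.realize v) (b.realize v) := by
  refine congrArg (Structure.funMap (L := geoLang) GeoConstruction.mid) (funext fun i => ?_)
  fin_cases i <;> rfl

theorem realize_cciTerm (a b c d e : geoLang.Term ι) : (cciTerm a b c d e).realize v =
    cci (a.realize v) (b.realize v) (c.realize v) (d.realize v) (e.realize v) := by
  refine congrArg (Structure.funMap (L := geoLang) GeoConstruction.cci) (funext fun i => ?_)
  fin_cases i <;> rfl

/-- The term for `Geo.layOff`. -/
def layOffTerm (p q r s : geoLang.Term ι) : geoLang.Term ι := extTerm (extTerm q p q p) p r s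

/-- The term for `Geo.mirror`. -/
def mirrorTerm (a b c : geoLang.Term ι) : geoLang.Term ι := atsTerm b a c b a (extTerm c a c a)

/-- The term for `Geo.meetOffLine`. -/
def meetOffLineTerm (a b c d : geoLang.Term ι) : geoLang.Term ι :=
  layOffTerm (midTerm c (mirrorTerm a b c)) b (midTerm c (mirrorTerm a b c))
    (cciTerm (mirrorTerm a b c) (layOffTerm (mirrorTerm a b c) c c d)
      (extTerm c (mirrorTerm a b c) c d) c d)

/-- The term for `Geo.nearer`. -/
def nearerTerm (b u e : geoLang.Term ι) : geoLang.Term ι :=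
  extTerm (extTerm b (midTerm e u) b (midTerm e u)) (midTerm e u) (midTerm e u) e

/-- The term for `Geo.meet`. -/
def meetTerm (a b c d : geoLang.Term ι) : geoLang.Term ι :=
  nearerTerm b
    (extTerm b (layOffTerm b a b (layOffTerm c b c d)) (layOffTerm b a b (layOffTerm c b c d))
      (meetOffLineTerm a b c d))
    (extTerm b (layOffTerm b a b (layOffTerm c b c d)) c (layOffTerm b a b c))

/-- The term for `Geo.secondMeet`. -/
def secondMeetTerm (c₁ a b c₂ d : geoLang.Term ι) : geoLang.Term ι :=
  atsTerm c₂ c₁ (cciTerm c₁ a b c₂ d) c₂ c₁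
    (extTerm (cciTerm c₁ a b c₂ d) c₁ (cciTerm c₁ a b c₂ d) c₁)

theorem realize_meetTerm (a b c d : geoLang.Term ι) : (meetTerm a b c d).realize v =
    meet (a.realize v) (b.realize v) (c.realize v) (d.realize v) := by
  simp only [meetTerm, nearerTerm, meetOffLineTerm, mirrorTerm, layOffTerm, realize_extTerm,
    realize_atsTerm, realize_midTerm, realize_cciTerm, meet, nearer, meetOffLine, mirror, layOff]

theorem realize_secondMeetTerm (c₁ a b c₂ d : geoLang.Term ι) :
    (secondMeetTerm c₁ a b c₂ d).realize v = secondMeet (c₁.realize v) (a.realize v)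
      (b.realize v) (c₂.realize v) (d.realize v) := by
  simp only [secondMeetTerm, realize_extTerm, realize_atsTerm, realize_cciTerm, secondMeet]

end Terms

end Geo

/-! ### The main theorem -/

theorem mainTheorem10 :
    (∃ t : UniformConstruction 4, ∀ (P : Type u) [geoLang.Structure P], Geo.IsPlane P →
      ∀ a b c d : P, Geo.SegLT c a c d → Geo.SegLT c d c b →
        Geo.B a (t.realize ![a, b, c, d]) b ∧ Geo.C c (t.realize ![a, b, c, d]) c d) ∧
    (∃ t : UniformConstruction 5, ∀ (P : Type u) [geoLang.Structure P], Geo.IsPlane P →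
      ∀ c₁ a b c₂ d : P,
        Geo.C c₁ a c₁ b → Geo.SegLT c₂ a c₂ d → Geo.SegLT c₂ d c₂ b →
        Geo.C c₁ (t.realize ![c₁, a, b, c₂, d]) c₁ a ∧
        Geo.C c₂ (t.realize ![c₁, a, b, c₂, d]) c₂ d ∧
        t.realize ![c₁, a, b, c₂, d] ≠ Geo.cci c₁ a b c₂ d) := by
  refine ⟨⟨Geo.meetTerm (.var 0) (.var 1) (.var 2) (.var 3), fun P _ h a b c d h1 h2 => ?_⟩,
    ⟨Geo.secondMeetTerm (.var 0) (.var 1) (.var 2) (.var 3) (.var 4),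
      fun P _ h c₁ a b c₂ d hC h1 h2 => ?_⟩⟩
  · rw [Geo.realize_meetTerm]
    have := h.meet_spec (h.segLT_iff.1 h1) (h.segLT_iff.1 h2)
    rw [h.dist_eq_iff] at this
    exact this
  · rw [Geo.realize_secondMeetTerm]
    have := h.secondMeet_spec (h.dist_eq_iff.2 hC) (h.segLT_iff.1 h1) (h.segLT_iff.1 h2)
    rw [h.dist_eq_iff, h.dist_eq_iff] at this
    exact this
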